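/- \textbf{Theorem (scalar source or scalar channel).} Let $k,n\ge 1$, $p\ge 0$. \emph{Source.} $S_{t+1}=AS_t+W_t$ for $t\ge 0$, where $A\in\mathbb R^{k\times k}$ has distinct eigenvalues $\lambda_1,\dots,\lambda_k\in\mathbb C$ with $|\lambda_j|>1$ for all $j$, $S_0\sim\mathcal N(0,Q)$, $W_t\sim\mathcal N(0,Q)$, and $Q\succ 0$. \emph{Channel (with noiseless feedback).} $Y_t=HX_t+Z_t$ for $t\ge 0$, where $Z_t\sim\mathcal N(0,I_n)$, $H=\mathrm{diag}(h_1,\dots,h_n)$ is real and $|h_1|\ge |h_2|\ge\dots\ge|h_n|$. \emph{Linear time-invariant codes.} The encoder is $X_t=\Gamma\,(S_t-\hat S_t)+M_t$ with $\hat S_t=\mathbb E[S_t\mid Y_0,\dots,Y_{t-1}]$ and $M_t\sim\mathcal N(0,\Omega)$, for a matrix $\Gamma\in\mathbb R^{n\times k}$ and a matrix $\Omega\succeq 0$ that do not depend on $t$. The random vectors $S_0$, $W_t$, $Z_t$, $M_t$ $(t\ge 0)$ are independent. The encoder must satisfy the power constraint $$\limsup_{T\to\infty}\frac1T\sum_{t=1}^T\mathbb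 E\|X_t\|^2\le p .$$ We say that linear time-invariant codes achieve finite MSE if for some such encoder there are measurable decoders $g_t$ with $$\limsup_{T\to\infty}\frac1T\sum_{t=1}^T\mathbb E\big\|S_t-g_t(Y_0,\dots,Y_{t-1})\big\|^2<\infty .$$ Suppose $n=1$ or $k=1$. Then linear time-invariant codes achieve finite MSE if and only if there are pairwise disjoint, possibly empty sets $\mathcal S_1,\dots,\mathcal S_n$ with union $\{1,\dots,k\}$, and $\pi_1,\dots,\pi_n\ge 0$ with $\sum_{i=1}^n\pi_i=p$, such that $$\sum_{j\in\mathcal S_i}\log|\lambda_j|<\tfrac12\log(1+h_i^2\pi_i)\qquad\text{for every } i \text{ with } \mathcal S_i\ne\emptyset. \qquad (*)$$ If $h_i\neq 0$ for all $i$, the same equivalence holds with the inequality in $(*)$ required for every $i=1,\dots,n$ (including those with $\mathcal S_i=\emptyset$). In particular, for a scalar channel ($n=1$), finite MSE is achievable if and only if $\sum_{j=1}^k\log|\lambda_j|<\tfrac12\log(1+h_1^2p)$. For a scalar source ($k=1$), finite MSE is achievable if and only if $\log|\lambda_1|<\tfrac12\log(1+h_1^2p)$, the condition in which the whole power is allocated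 to the best sub-channel. -/

import Mathlib

open MeasureTheory ProbabilityTheory Filter
open scoped NNReal ENNReal

noncomputable section

namespace CodedKalman

/-- Column vectors with `d` real entries, with the Euclidean norm. -/
abbrev Vec (d : ℕ) : Type := EuclideanSpace ℝ (Fin d)

/-- Labels of the independent primitive random vectors: the initial state, the process noise, the
channel noise and the private randomness of the encoder, at every time. -/
inductive NoiseIdx : Type
  | init : NoiseIdx
  | process (t : ℕ) : NoiseIdx
  | channel (t : ℕ) : NoiseIdx
  | encoder (t : ℕ) : NoiseIdx

/-- The dimension of each primitive random vector, for a `k`-dimensional source and `n`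
sub-channels. -/
def NoiseIdx.dim (k n : ℕ) : NoiseIdx → ℕ
  | .init => k
  | .process _ => k
  | .channel _ => n
  | .encoder _ => n

/-- The primitive random vectors as one family. -/
def noiseFamily {k n : ℕ} {Ω : Type} (S₀ : Ω → Vec k) (W : ℕ → Ω → Vec k)
    (Z M : ℕ → Ω → Vec n) : (i : NoiseIdx) → Ω → Vec (i.dim k n)
  | .init => S₀
  | .process t => W t
  | .channel t => Z t
  | .encoder t => M t

/-- The σ-algebra generated by the channel outputs `Y 0, …, Y (t - 1)`. -/
abbrev pastOutputs {n : ℕ} {Ω : Type} (Y : ℕ → Ω → Vec n) (t : ℕ) : MeasurableSpace Ω :=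
  ⨆ s : Fin t, MeasurableSpace.comap (Y s) inferInstance

/-- `S, W, Z, M, X, Y` is a realization, on the probability space `(Ω, μ)`, of

* the Gauss-Markov source `S (t+1) = A S t + W t`, with `S 0` and all `W t` of law `N(0, Q)`;
* the channel `Y t = H X t + Z t`, with `H = diag h` and `Z t` of law `N(0, I)`;
* the linear time-invariant innovations encoder `X t = Γ (S t - Ŝ t) + M t`, where
  `Ŝ t = E[S t | Y 0, …, Y (t-1)]` is the minimal mean-squared error prediction of the state that
  encoder (through feedback) and decoder share, and `M t` has law `N(0, Σ)`;

`S 0` and all `W t`, `Z t`, `M t` being independent. -/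
structure IsRealization {k n : ℕ} (A Q : Matrix (Fin k) (Fin k) ℝ) (h : Fin n → ℝ)
    (Γ : Matrix (Fin n) (Fin k) ℝ) (Sig : Matrix (Fin n) (Fin n) ℝ)
    {Ω : Type} [MeasurableSpace Ω] (μ : Measure Ω)
    (S W : ℕ → Ω → Vec k) (Z M X Y : ℕ → Ω → Vec n) : Prop where
  measurable_noise : ∀ i, Measurable (noiseFamily (S 0) W Z M i)
  indep : iIndepFun (noiseFamily (S 0) W Z M) μ
  law_init : HasLaw (S 0) (multivariateGaussian 0 Q) μ
  law_process : ∀ t, HasLaw (W t) (multivariateGaussian 0 Q) μ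
  law_channel : ∀ t, HasLaw (Z t) (multivariateGaussian 0 1) μ
  law_encoder : ∀ t, HasLaw (M t) (multivariateGaussian 0 Sig) μ
  source : ∀ t ω, S (t + 1) ω = A.toEuclideanLin (S t ω) + W t ω
  channel : ∀ t ω, Y t ω = (Matrix.diagonal h).toEuclideanLin (X t ω) + Z t ω
  encoder : ∀ t ω, X t ω = Γ.toEuclideanLin (S t ω - (μ[S t | pastOutputs Y t]) ω) + M t ω

/-- The long-term average `limsup_{T → ∞} (1/T) ∑_{t=1}^T u t`. -/
def longTermAverage (u : ℕ → ℝ≥0∞) : ℝ≥0∞ :=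
  limsup (fun T : ℕ => (∑ t ∈ Finset.Icc 1 T, u t) / (T : ℝ≥0∞)) atTop

/-- There is a `(p, D)` feedback code whose encoder is linear and time-invariant: the encoder's
average power is at most `p`, and some decoder, which estimates `S t` by a measurable function of
the channel outputs `Y 0, …, Y (t - 1)`, has average mean-squared error at most `D`. -/
def ExistsLTICode {k n : ℕ} (A Q : Matrix (Fin k) (Fin k) ℝ) (h : Fin n → ℝ)
    (p : ℝ) (D : ℝ≥0) : Prop :=
  ∃ (Γ : Matrix (Fin n) (Fin k) ℝ) (Sig : Matrix (Fin n) (Fin n) ℝ), Sig.PosSemidef ∧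
  ∃ (Ω : Type) (_ : MeasurableSpace Ω) (μ : Measure Ω) (_ : IsProbabilityMeasure μ)
    (S W : ℕ → Ω → Vec k) (Z M X Y : ℕ → Ω → Vec n),
    IsRealization A Q h Γ Sig μ S W Z M X Y ∧
    longTermAverage (fun t => ∫⁻ ω, ‖X t ω‖ₑ ^ 2 ∂μ) ≤ ENNReal.ofReal p ∧
    ∃ g : (t : ℕ) → (Fin t → Vec n) → Vec k, (∀ t, Measurable (g t)) ∧
      longTermAverage (fun t => ∫⁻ ω, ‖S t ω - g t (fun s : Fin t => Y s ω)‖ₑ ^ 2 ∂μ) ≤ D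

/-- Finite asymptotic mean-squared error is achievable with power `p` by linear time-invariant
codes. -/
def FiniteMSEAchievable {k n : ℕ} (A Q : Matrix (Fin k) (Fin k) ℝ) (h : Fin n → ℝ)
    (p : ℝ) : Prop :=
  ∃ D : ℝ≥0, ExistsLTICode A Q h p D

/-- The capacity (in nats) of a scalar AWGN channel with gain `g` and power `π`. -/
def capacity (g π : ℝ) : ℝ := 1 / 2 * Real.log (1 + g ^ 2 * π)

/-- `𝒮 1, …, 𝒮 n` are pairwise disjoint (possibly empty) sets that cover all the modes, and
`π` is an allocation of the power `p` to the `n` sub-channels. -/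
structure IsAllocation {k n : ℕ} (p : ℝ) (𝒮 : Fin n → Finset (Fin k)) (π : Fin n → ℝ) :
    Prop where
  disjoint : Pairwise fun i j => Disjoint (𝒮 i) (𝒮 j)
  cover : ∀ j, ∃ i, j ∈ 𝒮 i
  nonneg : ∀ i, 0 ≤ π i
  sum_eq : ∑ i, π i = p

/-- The partition and power-allocation condition, required of every sub-channel, including those
to which no mode is assigned (these then need a positive capacity). -/
def PartitionCondition {k n : ℕ} (lam : Fin k → ℂ) (h : Fin n → ℝ) (p : ℝ) : Prop :=
  ∃ (𝒮 : Fin n → Finset (Fin k)) (π : Fin n → ℝ), IsAllocation p 𝒮 π ∧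
    ∀ i, ∑ j ∈ 𝒮 i, Real.log ‖lam j‖ < capacity (h i) (π i)

/-- The partition and power-allocation condition, required of the sub-channels in use, to which
some mode is assigned. -/
def ActivePartitionCondition {k n : ℕ} (lam : Fin k → ℂ) (h : Fin n → ℝ) (p : ℝ) : Prop :=
  ∃ (𝒮 : Fin n → Finset (Fin k)) (π : Fin n → ℝ), IsAllocation p 𝒮 π ∧
    ∀ i, (𝒮 i).Nonempty → ∑ j ∈ 𝒮 i, Real.log ‖lam j‖ < capacity (h i) (π i)

end CodedKalman

end

/-!
In both cases the first sub-channel, with the whole power, is the best choice, and the theorem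
reduces to the statement that finite mean-squared error is achievable if and only if
`det A ^ 2 < 1 + h₀ ^ 2 * p`, where `|det A| = ∏ j, ‖lam j‖` (`finiteMSEAchievable_iff`).

The link between codes and matrices is the Kalman filter (`kalman_step`,
`IsRealization.hasLaw_predictionError`). With `G = diag h * Γ`, the channel output is `G e + N`,
where the prediction error `e` is Gaussian and independent of the past outputs. Subtracting the
Kalman gain times the output from `e` leaves a vector that is uncorrelated with the output, hence
independent of it, and therefore independent of all outputs so far. The covariance `P t` of the
prediction error thus follows the Riccati recursion `errorCov`. The power is `tr (Γ P Γᵀ + Σ)`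
(`IsRealization.lintegral_enorm_sq_input`), and no decoder has a mean-squared error below `tr P`
(`IsRealization.ofReal_trace_le_lintegral`).

*Converse.* Since the signal part of the output has rank at most one, a measurement divides the
determinant of the error covariance by at most `1 + h₀ ^ 2 * a`, with `a` the current power. The
dynamics multiply it by `det A ^ 2`, and the process noise contributes the further factor
`1 + tr Q / tr P` (`det_errorCov_succ`). Taking logarithms and averaging over time, bounded average
power and error leave no room for equality (`rate_lt_of_bounded_average`).

*Achievability.* Choose a row vector `c` that makes the pair observable, and let `X` solve
`Aᵀ X A = X + cᵀ c`. Without process noise, the Kalman filter for the output `c e` has the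
stationary covariance `X⁻¹`, and `1 + c X⁻¹ cᵀ = det A ^ 2`. If the encoder sends `a c e` with a
small scale `a`, the corresponding filter, which is suboptimal in the presence of process noise, has
an error covariance at most `a⁻² X⁻¹ + N` with `N` independent of `a`. This bounds the optimal
covariance (`posSemidef_sub_errorCov`), and the received power is at most
`det A ^ 2 - 1 + a ^ 2 * c N cᵀ` (`finiteMSEAchievable_of_det_sq_lt`).
-/

noncomputable section

namespace CodedKalman

open Matrix

/-! ### Centered Gaussian vectors -/

section Gaussian

variable {Ω : Type*} [MeasurableSpace Ω] {μ : Measure Ω}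

lemma inner_toEuclideanLin_left {a b : ℕ} (B : Matrix (Fin a) (Fin b) ℝ) (x : Vec b) (t : Vec a) :
    inner ℝ (B.toEuclideanLin x) t = inner ℝ x (Bᵀ.toEuclideanLin t) := by
  rw [← conjTranspose_eq_transpose_of_trivial, toEuclideanLin_conjTranspose_eq_adjoint,
    LinearMap.adjoint_inner_right]

lemma measurable_toEuclideanLin {a b : ℕ} (B : Matrix (Fin a) (Fin b) ℝ) :
    Measurable (fun x : Vec b => B.toEuclideanLin x) :=
  (LinearMap.continuous_of_finiteDimensional _).measurable

lemma dotProduct_transpose_toEuclideanLin {a b : ℕ} (B : Matrix (Fin a) (Fin b) ℝ)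
    (P : Matrix (Fin b) (Fin b) ℝ) (s t : Vec a) :
    (Bᵀ.toEuclideanLin s).ofLp ⬝ᵥ P *ᵥ (Bᵀ.toEuclideanLin t).ofLp
      = s.ofLp ⬝ᵥ (B * P * Bᵀ) *ᵥ t.ofLp := by
  simp only [toLpLin_apply, ← mulVec_mulVec, mulVec_transpose B s.ofLp, dotProduct_mulVec]

lemma posSemidef_conj {a b : ℕ} (B : Matrix (Fin a) (Fin b) ℝ) {P : Matrix (Fin b) (Fin b) ℝ}
    (hP : P.PosSemidef) : (B * P * Bᵀ).PosSemidef := by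
  simpa [conjTranspose_eq_transpose_of_trivial] using hP.mul_mul_conjTranspose_same B

/-- The joint characteristic function of two independent centered Gaussian vectors. -/
lemma integral_exp_inner_add_inner [IsProbabilityMeasure μ] {a b : ℕ}
    {P : Matrix (Fin a) (Fin a) ℝ}
    {R : Matrix (Fin b) (Fin b) ℝ} (hP : P.PosSemidef) (hR : R.PosSemidef) {X : Ω → Vec a}
    {Y : Ω → Vec b} (hX : HasLaw X (multivariateGaussian 0 P) μ)
    (hY : HasLaw Y (multivariateGaussian 0 R) μ) (hXY : IndepFun X Y μ) (u : Vec a) (v : Vec b) :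
    ∫ ω, Complex.exp (((inner ℝ (X ω) u + inner ℝ (Y ω) v : ℝ) : ℂ) * Complex.I) ∂μ
      = Complex.exp (-(((u.ofLp ⬝ᵥ P *ᵥ u.ofLp + v.ofLp ⬝ᵥ R *ᵥ v.ofLp : ℝ) : ℂ) / 2)) := by
  have h1 : ∫ ω, Complex.exp ((inner ℝ (X ω) u : ℝ) * Complex.I) ∂μ
      = Complex.exp (-(((u.ofLp ⬝ᵥ P *ᵥ u.ofLp : ℝ) : ℂ) / 2)) := by
    have := charFun_multivariateGaussian (μ := 0) hP u
    rw [← hX.map_eq, charFun_apply,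
      integral_map hX.aemeasurable (by fun_prop)] at this
    rw [this]; simp
  have h2 : ∫ ω, Complex.exp ((inner ℝ (Y ω) v : ℝ) * Complex.I) ∂μ
      = Complex.exp (-(((v.ofLp ⬝ᵥ R *ᵥ v.ofLp : ℝ) : ℂ) / 2)) := by
    have := charFun_multivariateGaussian (μ := 0) hR v
    rw [← hY.map_eq, charFun_apply,
      integral_map hY.aemeasurable (by fun_prop)] at this
    rw [this]; simp
  have h3 := hXY.integral_fun_comp_mul_comp (𝕜 := ℂ)
    (f := fun x => Complex.exp ((inner ℝ x u : ℝ) * Complex.I))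
    (g := fun y => Complex.exp ((inner ℝ y v : ℝ) * Complex.I)) hX.aemeasurable hY.aemeasurable
    (by fun_prop) (by fun_prop)
  rw [h1, h2, ← Complex.exp_add] at h3
  simp only [← Complex.exp_add] at h3
  convert h3 using 1
  · refine integral_congr_ae (.of_forall fun ω => ?_)
    push_cast
    ring_nf
  · push_cast
    ring_nf

lemma hasLaw_gaussian_of_integral_exp [IsProbabilityMeasure μ] {a : ℕ}
    {P : Matrix (Fin a) (Fin a) ℝ} (hP : P.PosSemidef) {X : Ω → Vec a} (hX : AEMeasurable X μ)
    (h : ∀ u : Vec a, ∫ ω, Complex.exp (((inner ℝ (X ω) u : ℝ) : ℂ) * Complex.I) ∂μ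
      = Complex.exp (-(((u.ofLp ⬝ᵥ P *ᵥ u.ofLp : ℝ) : ℂ) / 2))) :
    HasLaw X (multivariateGaussian 0 P) μ := by
  have := Measure.isProbabilityMeasure_map (μ := μ) hX
  refine ⟨hX, Measure.ext_of_charFun (funext fun u => ?_)⟩
  rw [charFun_multivariateGaussian hP, charFun_apply, integral_map hX (by fun_prop), h]
  simp

/-- A linear combination of two independent centered Gaussian vectors. -/
lemma hasLaw_gaussian_add [IsProbabilityMeasure μ] {a b c : ℕ} {P : Matrix (Fin a) (Fin a) ℝ}
    {R : Matrix (Fin b) (Fin b) ℝ} (hP : P.PosSemidef) (hR : R.PosSemidef) {X : Ω → Vec a}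
    {Y : Ω → Vec b} (hX : HasLaw X (multivariateGaussian 0 P) μ)
    (hY : HasLaw Y (multivariateGaussian 0 R) μ) (hXY : IndepFun X Y μ)
    (B : Matrix (Fin c) (Fin a) ℝ) (C : Matrix (Fin c) (Fin b) ℝ) :
    HasLaw (fun ω => B.toEuclideanLin (X ω) + C.toEuclideanLin (Y ω))
      (multivariateGaussian 0 (B * P * Bᵀ + C * R * Cᵀ)) μ := by
  refine hasLaw_gaussian_of_integral_exp ((posSemidef_conj B hP).add (posSemidef_conj C hR)) ?_ ?_
  · exact ((measurable_toEuclideanLin B).comp_aemeasurable hX.aemeasurable).add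
      ((measurable_toEuclideanLin C).comp_aemeasurable hY.aemeasurable)
  · intro u
    simp only [inner_add_left, inner_toEuclideanLin_left]
    rw [integral_exp_inner_add_inner hP hR hX hY hXY, dotProduct_transpose_toEuclideanLin,
      dotProduct_transpose_toEuclideanLin, add_mulVec, dotProduct_add]

lemma hasLaw_gaussian_map [IsProbabilityMeasure μ] {a c : ℕ} {P : Matrix (Fin a) (Fin a) ℝ}
    (hP : P.PosSemidef) {X : Ω → Vec a} (hX : HasLaw X (multivariateGaussian 0 P) μ)
    (B : Matrix (Fin c) (Fin a) ℝ) :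
    HasLaw (fun ω => B.toEuclideanLin (X ω)) (multivariateGaussian 0 (B * P * Bᵀ)) μ := by
  have h0 : HasLaw (fun _ : Ω => (0 : Vec 0)) (multivariateGaussian 0 0) μ := by
    refine hasLaw_gaussian_of_integral_exp .zero aemeasurable_const fun u => ?_
    simp
  simpa using hasLaw_gaussian_add hP .zero hX h0 (indepFun_const_right _ _) B 0

/-- Two linear combinations of independent centered Gaussian vectors that are uncorrelated are
independent. -/
lemma indepFun_gaussian_of_uncorrelated [IsProbabilityMeasure μ] {a b c d : ℕ}
    {P : Matrix (Fin a) (Fin a) ℝ}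
    {R : Matrix (Fin b) (Fin b) ℝ} (hP : P.PosSemidef) (hR : R.PosSemidef) {X : Ω → Vec a}
    {Y : Ω → Vec b} (hX : HasLaw X (multivariateGaussian 0 P) μ)
    (hY : HasLaw Y (multivariateGaussian 0 R) μ) (hXY : IndepFun X Y μ)
    (B : Matrix (Fin c) (Fin a) ℝ) (C : Matrix (Fin c) (Fin b) ℝ)
    (B' : Matrix (Fin d) (Fin a) ℝ) (C' : Matrix (Fin d) (Fin b) ℝ)
    (h0 : B * P * B'ᵀ + C * R * C'ᵀ = 0) :
    IndepFun (fun ω => B.toEuclideanLin (X ω) + C.toEuclideanLin (Y ω))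
      (fun ω => B'.toEuclideanLin (X ω) + C'.toEuclideanLin (Y ω)) μ := by
  have hm1 := (hasLaw_gaussian_add hP hR hX hY hXY B C)
  have hm2 := (hasLaw_gaussian_add hP hR hX hY hXY B' C')
  rw [indepFun_iff_charFun_prod hm1.aemeasurable hm2.aemeasurable]
  rintro t
  obtain ⟨s, r⟩ := t
  rw [hm1.map_eq, hm2.map_eq, charFun_multivariateGaussian
    ((posSemidef_conj B hP).add (posSemidef_conj C hR)), charFun_multivariateGaussian
    ((posSemidef_conj B' hP).add (posSemidef_conj C' hR)), charFun_apply,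
    integral_map (by
      have := hm1.aemeasurable
      have := hm2.aemeasurable
      fun_prop) (by fun_prop)]
  have key := integral_exp_inner_add_inner hP hR hX hY hXY
    (Bᵀ.toEuclideanLin s + B'ᵀ.toEuclideanLin r) (Cᵀ.toEuclideanLin s + C'ᵀ.toEuclideanLin r)
  have e1 : ∀ ω, inner ℝ (WithLp.toLp 2 (B.toEuclideanLin (X ω) + C.toEuclideanLin (Y ω),
        B'.toEuclideanLin (X ω) + C'.toEuclideanLin (Y ω))) (WithLp.toLp 2 (s, r))
      = inner ℝ (X ω) (Bᵀ.toEuclideanLin s + B'ᵀ.toEuclideanLin r)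
        + inner ℝ (Y ω) (Cᵀ.toEuclideanLin s + C'ᵀ.toEuclideanLin r) := by
    intro ω
    simp only [WithLp.prod_inner_apply, inner_add_left, inner_add_right, inner_toEuclideanLin_left]
    ring
  simp only [e1]
  rw [key, ← Complex.exp_add]
  congr 1
  have sym : ∀ {m : ℕ} (U : Matrix (Fin m) (Fin m) ℝ), U.PosSemidef → ∀ x y : Fin m → ℝ,
      x ⬝ᵥ U *ᵥ y = y ⬝ᵥ U *ᵥ x := by
    intro m U hU x y
    have : Uᵀ = U := by simpa [conjTranspose_eq_transpose_of_trivial] using hU.isHermitian.eq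
    rw [dotProduct_mulVec, ← mulVec_transpose, this, dotProduct_comm]
  have cross : (Bᵀ.toEuclideanLin s).ofLp ⬝ᵥ P *ᵥ (B'ᵀ.toEuclideanLin r).ofLp
      + (Cᵀ.toEuclideanLin s).ofLp ⬝ᵥ R *ᵥ (C'ᵀ.toEuclideanLin r).ofLp = 0 := by
    have := congrArg (fun U => s.ofLp ⬝ᵥ U *ᵥ r.ofLp) h0
    simp only [add_mulVec, dotProduct_add, zero_mulVec, dotProduct_zero] at this
    rw [← this]
    simp only [toLpLin_apply, ← mulVec_mulVec, mulVec_transpose _ s.ofLp, dotProduct_mulVec]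
  have expand : (Bᵀ.toEuclideanLin s + B'ᵀ.toEuclideanLin r).ofLp ⬝ᵥ
        P *ᵥ (Bᵀ.toEuclideanLin s + B'ᵀ.toEuclideanLin r).ofLp
      + (Cᵀ.toEuclideanLin s + C'ᵀ.toEuclideanLin r).ofLp ⬝ᵥ
        R *ᵥ (Cᵀ.toEuclideanLin s + C'ᵀ.toEuclideanLin r).ofLp
      = s.ofLp ⬝ᵥ (B * P * Bᵀ + C * R * Cᵀ) *ᵥ s.ofLp
        + r.ofLp ⬝ᵥ (B' * P * B'ᵀ + C' * R * C'ᵀ) *ᵥ r.ofLp := by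
    have s1 := sym P hP (Bᵀ.toEuclideanLin s).ofLp (B'ᵀ.toEuclideanLin r).ofLp
    have s2 := sym R hR (Cᵀ.toEuclideanLin s).ofLp (C'ᵀ.toEuclideanLin r).ofLp
    simp only [add_mulVec, dotProduct_add, ← dotProduct_transpose_toEuclideanLin, WithLp.ofLp_add,
      mulVec_add, add_dotProduct]
    linarith
  rw [expand]
  simp
  ring

/-- The mean-squared norm of a centered Gaussian vector is the trace of its covariance. -/
lemma lintegral_enorm_sq_gaussian {a : ℕ} {P : Matrix (Fin a) (Fin a) ℝ}
    (hP : P.PosSemidef) {X : Ω → Vec a} (hX : HasLaw X (multivariateGaussian 0 P) μ) :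
    ∫⁻ ω, ‖X ω‖ₑ ^ 2 ∂μ = ENNReal.ofReal P.trace := by
  have h1 : ∫⁻ ω, ‖X ω‖ₑ ^ 2 ∂μ = ∫⁻ x, ‖x‖ₑ ^ 2 ∂(multivariateGaussian (0 : Vec a) P) := by
    rw [← hX.map_eq, lintegral_map' (by fun_prop) hX.aemeasurable]
  have h2 : ∀ i, ∫ x : Vec a, x i ∂(multivariateGaussian (0 : Vec a) P) = 0 := by
    intro i
    have h := (EuclideanSpace.proj i : Vec a →L[ℝ] ℝ).integral_comp_comm
      (μ := multivariateGaussian (0 : Vec a) P) (φ := fun x => x) IsGaussian.integrable_fun_id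
    rw [integral_id_multivariateGaussian, map_zero] at h
    exact h
  have hml : ∀ i, MemLp (fun x : Vec a => x i) 2 (multivariateGaussian (0 : Vec a) P) := by
    intro i
    exact (EuclideanSpace.proj i : Vec a →L[ℝ] ℝ).comp_memLp'
      (IsGaussian.memLp_two_id (μ := multivariateGaussian (0 : Vec a) P))
  have h3 : ∀ i, ∫ x : Vec a, (x i) ^ 2 ∂(multivariateGaussian (0 : Vec a) P) = P i i := by
    intro i
    rw [← variance_eval_multivariateGaussian (μ := 0) hP i,
      variance_of_integral_eq_zero (hml i).aemeasurable (h2 i)]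
  have h4 : ∀ i, Integrable (fun x : Vec a => (x i) ^ 2) (multivariateGaussian (0 : Vec a) P) :=
    fun i => (hml i).integrable_sq
  have h5 : ∫ x : Vec a, ‖x‖ ^ 2 ∂(multivariateGaussian (0 : Vec a) P) = P.trace := by
    simp only [EuclideanSpace.real_norm_sq_eq]
    rw [integral_finsetSum _ fun i _ => h4 i]
    simp [h3, Matrix.trace]
  rw [h1, ← h5, ofReal_integral_eq_lintegral_ofReal]
  · refine lintegral_congr fun x => ?_
    rw [ENNReal.ofReal_pow (norm_nonneg _), ofReal_norm]
  · simp only [EuclideanSpace.real_norm_sq_eq]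
    exact integrable_finsetSum _ fun i _ => h4 i
  · exact .of_forall fun x => by positivity

end Gaussian

/-! ### Independence and the σ-algebras of the noises -/

section Independence

variable {Ω : Type*} {mΩ : MeasurableSpace Ω} {μ : Measure Ω}

lemma generateFrom_image2_inter (m₁ m₂ : MeasurableSpace Ω) :
    MeasurableSpace.generateFrom
      (Set.image2 (· ∩ ·) {s | MeasurableSet[m₁] s} {s | MeasurableSet[m₂] s}) = m₁ ⊔ m₂ := by
  apply le_antisymm
  · refine MeasurableSpace.generateFrom_le ?_
    rintro _ ⟨s, hs, t, ht, rfl⟩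
    exact ((le_sup_left : m₁ ≤ m₁ ⊔ m₂) s hs).inter ((le_sup_right : m₂ ≤ m₁ ⊔ m₂) t ht)
  · refine sup_le (fun s hs => ?_) (fun s hs => ?_)
    · exact MeasurableSpace.measurableSet_generateFrom
        ⟨s, hs, Set.univ, MeasurableSet.univ, by simp⟩
    · exact MeasurableSpace.measurableSet_generateFrom
        ⟨Set.univ, MeasurableSet.univ, s, hs, by simp⟩

lemma isPiSystem_image2_inter (m₁ m₂ : MeasurableSpace Ω) :
    IsPiSystem (Set.image2 (· ∩ ·) {s | MeasurableSet[m₁] s} {s | MeasurableSet[m₂] s}) := by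
  rintro _ ⟨s, hs, t, ht, rfl⟩ _ ⟨s', hs', t', ht', rfl⟩ -
  exact ⟨s ∩ s', MeasurableSet.inter hs hs', t ∩ t', MeasurableSet.inter ht ht',
    Set.inter_inter_inter_comm _ _ _ _⟩

lemma indep_sup_right_of_indep_sup_left [IsProbabilityMeasure μ] {m₁ m₂ m₃ : MeasurableSpace Ω}
    (h₁ : m₁ ≤ mΩ) (h₂ : m₂ ≤ mΩ) (h₃ : m₃ ≤ mΩ) (h₁₂ : Indep m₁ m₂ μ)
    (h : Indep (m₁ ⊔ m₂) m₃ μ) : Indep m₁ (m₂ ⊔ m₃) μ := by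
  refine IndepSets.indep h₁ (sup_le h₂ h₃) (@MeasurableSpace.isPiSystem_measurableSet Ω m₁)
    (isPiSystem_image2_inter m₂ m₃) (@MeasurableSpace.generateFrom_measurableSet Ω m₁).symm
    (generateFrom_image2_inter m₂ m₃).symm ?_
  rw [IndepSets_iff]
  rintro s _ hs ⟨t, ht, r, hr, rfl⟩
  rw [Indep_iff] at h₁₂ h
  have hst : MeasurableSet[m₁ ⊔ m₂] (s ∩ t) :=
    ((le_sup_left : m₁ ≤ m₁ ⊔ m₂) s hs).inter ((le_sup_right : m₂ ≤ m₁ ⊔ m₂) t ht)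
  have htr := h t r ((le_sup_right : m₂ ≤ m₁ ⊔ m₂) t ht) hr
  simp only
  rw [← Set.inter_assoc, h _ _ hst hr, h₁₂ s t hs ht, htr, mul_assoc]

end Independence

/-- The labels of the primitive random vectors that determine the state at time `t` and the channel
outputs before time `t`. -/
def NoiseIdx.past (t : ℕ) : Set NoiseIdx
  | .init => True
  | .process s => s < t
  | .channel s => s < t
  | .encoder s => s < t

lemma NoiseIdx.past_mono {s t : ℕ} (hst : s ≤ t) : NoiseIdx.past s ⊆ NoiseIdx.past t := by
  rintro (_ | r | r | r) h
  · trivial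
  all_goals exact lt_of_lt_of_le (show r < s from h) hst

lemma NoiseIdx.process_notMem_past (t : ℕ) : NoiseIdx.process t ∉ NoiseIdx.past t :=
  lt_irrefl t

lemma NoiseIdx.channel_notMem_past (t : ℕ) : NoiseIdx.channel t ∉ NoiseIdx.past t :=
  lt_irrefl t

lemma NoiseIdx.encoder_notMem_past (t : ℕ) : NoiseIdx.encoder t ∉ NoiseIdx.past t :=
  lt_irrefl t

/-- The covariance of the noise that the linear time-invariant encoder and the channel add to the
transmitted innovation. -/
def outputNoiseCov {n : ℕ} (h : Fin n → ℝ) (Sig : Matrix (Fin n) (Fin n) ℝ) :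
    Matrix (Fin n) (Fin n) ℝ :=
  diagonal h * Sig * (diagonal h)ᵀ + 1

/-- The error covariance after a measurement `G e + N` of a centered vector `e` of covariance `P`,
with noise covariance `R`, when the estimate is corrected with the gain `K`. -/
def updateCov {k n : ℕ} (P : Matrix (Fin k) (Fin k) ℝ) (G : Matrix (Fin n) (Fin k) ℝ)
    (R : Matrix (Fin n) (Fin n) ℝ) (K : Matrix (Fin k) (Fin n) ℝ) : Matrix (Fin k) (Fin k) ℝ :=
  (1 - K * G) * P * (1 - K * G)ᵀ + K * R * Kᵀ

/-- The Kalman gain. -/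
def kalmanGain {k n : ℕ} (P : Matrix (Fin k) (Fin k) ℝ) (G : Matrix (Fin n) (Fin k) ℝ)
    (R : Matrix (Fin n) (Fin n) ℝ) : Matrix (Fin k) (Fin n) ℝ :=
  P * Gᵀ * (G * P * Gᵀ + R)⁻¹

/-- The covariance of the optimal prediction error at time `t` (the Riccati recursion). -/
def errorCov {k n : ℕ} (A Q : Matrix (Fin k) (Fin k) ℝ) (G : Matrix (Fin n) (Fin k) ℝ)
    (R : Matrix (Fin n) (Fin n) ℝ) : ℕ → Matrix (Fin k) (Fin k) ℝ
  | 0 => Q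
  | t + 1 => A * updateCov (errorCov A Q G R t) G R (kalmanGain (errorCov A Q G R t) G R) * Aᵀ + Q

section Covariance

variable {k n : ℕ}

lemma posDef_outputNoiseCov (h : Fin n → ℝ) {Sig : Matrix (Fin n) (Fin n) ℝ}
    (hSig : Sig.PosSemidef) : (outputNoiseCov h Sig).PosDef :=
  PosDef.posSemidef_add (posSemidef_conj _ hSig) .one

lemma posSemidef_updateCov {P : Matrix (Fin k) (Fin k) ℝ} (hP : P.PosSemidef)
    (G : Matrix (Fin n) (Fin k) ℝ) {R : Matrix (Fin n) (Fin n) ℝ} (hR : R.PosSemidef)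
    (K : Matrix (Fin k) (Fin n) ℝ) : (updateCov P G R K).PosSemidef :=
  (posSemidef_conj _ hP).add (posSemidef_conj _ hR)

lemma posSemidef_errorCov (A : Matrix (Fin k) (Fin k) ℝ) {Q : Matrix (Fin k) (Fin k) ℝ}
    (hQ : Q.PosSemidef) (G : Matrix (Fin n) (Fin k) ℝ) {R : Matrix (Fin n) (Fin n) ℝ}
    (hR : R.PosSemidef) (t : ℕ) : (errorCov A Q G R t).PosSemidef := by
  induction t with
  | zero => exact hQ
  | succ t ih => exact (posSemidef_conj _ (posSemidef_updateCov ih G hR _)).add hQ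

lemma posDef_innovationCov {P : Matrix (Fin k) (Fin k) ℝ} (hP : P.PosSemidef)
    (G : Matrix (Fin n) (Fin k) ℝ) {R : Matrix (Fin n) (Fin n) ℝ} (hR : R.PosDef) :
    (G * P * Gᵀ + R).PosDef :=
  PosDef.posSemidef_add (posSemidef_conj _ hP) hR

lemma kalmanGain_mul {P : Matrix (Fin k) (Fin k) ℝ} (hP : P.PosSemidef)
    (G : Matrix (Fin n) (Fin k) ℝ) {R : Matrix (Fin n) (Fin n) ℝ} (hR : R.PosDef) :
    kalmanGain P G R * (G * P * Gᵀ + R) = P * Gᵀ := by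
  have := (posDef_innovationCov hP G hR).isUnit
  rw [kalmanGain, Matrix.mul_assoc, nonsing_inv_mul _ ((isUnit_iff_isUnit_det _).mp this),
    Matrix.mul_one]

/-- The orthogonality principle: with the Kalman gain, the updated error is uncorrelated with the
measurement. -/
lemma kalmanGain_orthogonality {P : Matrix (Fin k) (Fin k) ℝ} (hP : P.PosSemidef)
    (G : Matrix (Fin n) (Fin k) ℝ) {R : Matrix (Fin n) (Fin n) ℝ} (hR : R.PosDef) :
    (1 - kalmanGain P G R * G) * P * Gᵀ = kalmanGain P G R * R := by
  have := kalmanGain_mul hP G hR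
  rw [Matrix.mul_add] at this
  rw [Matrix.sub_mul, Matrix.sub_mul, Matrix.one_mul, ← this]
  simp [Matrix.mul_assoc]

end Covariance

namespace IsRealization

variable {k n : ℕ} {A Q : Matrix (Fin k) (Fin k) ℝ} {h : Fin n → ℝ}
    {Γ : Matrix (Fin n) (Fin k) ℝ} {Sig : Matrix (Fin n) (Fin n) ℝ}
    {Ω : Type} {mΩ : MeasurableSpace Ω} {μ : Measure Ω}
    {S W : ℕ → Ω → Vec k} {Z M X Y : ℕ → Ω → Vec n}

/-- The σ-algebra generated by the primitive random vectors with labels in `I`. -/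
abbrev noiseSigma (S₀ : Ω → Vec k) (W : ℕ → Ω → Vec k) (Z M : ℕ → Ω → Vec n) (I : Set NoiseIdx) :
    MeasurableSpace Ω :=
  ⨆ i ∈ I, MeasurableSpace.comap (noiseFamily S₀ W Z M i) inferInstance

lemma noiseSigma_mono {S₀ : Ω → Vec k} {I J : Set NoiseIdx} (hIJ : I ⊆ J) :
    noiseSigma S₀ W Z M I ≤ noiseSigma S₀ W Z M J :=
  biSup_mono fun _ hi => hIJ hi

lemma measurable_noiseSigma {S₀ : Ω → Vec k} {I : Set NoiseIdx} {i : NoiseIdx} (hi : i ∈ I) :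
    Measurable[noiseSigma S₀ W Z M I] (noiseFamily S₀ W Z M i) :=
  (comap_measurable _).mono
    (le_biSup (fun i => MeasurableSpace.comap (noiseFamily S₀ W Z M i) inferInstance) hi) le_rfl

variable (hr : IsRealization A Q h Γ Sig μ S W Z M X Y)

include hr

lemma noiseSigma_le (I : Set NoiseIdx) : noiseSigma (S 0) W Z M I ≤ mΩ :=
  iSup₂_le fun i _ => (hr.measurable_noise i).comap_le

lemma indep_noiseSigma {I J : Set NoiseIdx} (hIJ : Disjoint I J) :
    Indep (noiseSigma (S 0) W Z M I) (noiseSigma (S 0) W Z M J) μ :=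
  indep_iSup_of_disjoint (fun i => (hr.measurable_noise i).comap_le)
    ((iIndepFun_iff_iIndep _ _ _).mp hr.indep) hIJ

lemma measurable_state_past (t : ℕ) :
    Measurable[noiseSigma (S 0) W Z M (NoiseIdx.past t)] (S t) := by
  induction t with
  | zero => exact measurable_noiseSigma (i := .init) trivial
  | succ t ih =>
    have h1 := ih.mono (noiseSigma_mono (NoiseIdx.past_mono t.le_succ)) le_rfl
    have h2 : Measurable[noiseSigma (S 0) W Z M (NoiseIdx.past (t + 1))] (W t) :=
      measurable_noiseSigma (i := .process t) (Nat.lt_succ_self t)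
    have : S (t + 1) = fun ω => A.toEuclideanLin (S t ω) + W t ω := funext (hr.source t)
    rw [this]
    exact ((measurable_toEuclideanLin A).comp h1).add h2

lemma measurable_output_past {s t : ℕ} (hst : s < t) :
    Measurable[noiseSigma (S 0) W Z M (NoiseIdx.past t)] (Y s) := by
  induction s using Nat.strong_induction_on generalizing t with
  | _ s ih =>
    have hle : pastOutputs Y s ≤ noiseSigma (S 0) W Z M (NoiseIdx.past t) :=
      iSup_le fun r => (ih r r.2 (r.2.trans hst)).comap_le
    have h1 : Measurable[noiseSigma (S 0) W Z M (NoiseIdx.past t)] (μ[S s | pastOutputs Y s]) :=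
      stronglyMeasurable_condExp.measurable.mono hle le_rfl
    have h2 := (hr.measurable_state_past s).mono
      (noiseSigma_mono (W := W) (Z := Z) (M := M) (NoiseIdx.past_mono hst.le)) le_rfl
    have h3 : Measurable[noiseSigma (S 0) W Z M (NoiseIdx.past t)] (Z s) :=
      measurable_noiseSigma (i := .channel s) hst
    have h4 : Measurable[noiseSigma (S 0) W Z M (NoiseIdx.past t)] (M s) :=
      measurable_noiseSigma (i := .encoder s) hst
    have : Y s = fun ω => (diagonal h).toEuclideanLin
        (Γ.toEuclideanLin (S s ω - (μ[S s | pastOutputs Y s]) ω) + M s ω) + Z s ω :=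
      funext fun ω => by rw [hr.channel, hr.encoder]
    rw [this]
    exact ((measurable_toEuclideanLin _).comp
      (((measurable_toEuclideanLin _).comp (h2.sub h1)).add h4)).add h3

lemma pastOutputs_le_past (t : ℕ) :
    pastOutputs Y t ≤ noiseSigma (S 0) W Z M (NoiseIdx.past t) :=
  iSup_le fun r => (hr.measurable_output_past r.2).comap_le

lemma pastOutputs_le (t : ℕ) : pastOutputs Y t ≤ mΩ :=
  (hr.pastOutputs_le_past t).trans (hr.noiseSigma_le _)

omit hr in
lemma pastOutputs_succ (t : ℕ) :
    pastOutputs Y (t + 1) = MeasurableSpace.comap (Y t) inferInstance ⊔ pastOutputs Y t := by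
  apply le_antisymm
  · refine iSup_le fun s => ?_
    rcases Nat.lt_succ_iff_lt_or_eq.mp s.2 with hs | hs
    · exact (le_iSup (fun s : Fin t => MeasurableSpace.comap (Y s) inferInstance)
        ⟨s, hs⟩).trans le_sup_right
    · rw [hs]; exact le_sup_left
  · refine sup_le ?_ (iSup_le fun s => ?_)
    · exact le_iSup (fun s : Fin (t + 1) => MeasurableSpace.comap (Y s) inferInstance)
        ⟨t, t.lt_succ_self⟩
    · exact le_iSup (fun s : Fin (t + 1) => MeasurableSpace.comap (Y s) inferInstance)
        ⟨s, s.2.trans t.lt_succ_self⟩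

end IsRealization

/-! ### The Kalman filter -/

/-- The error `S t - E[S t | Y 0, …, Y (t-1)]` of the optimal prediction of the state. -/
def predictionError {k n : ℕ} {Ω : Type} {mΩ : MeasurableSpace Ω} (μ : Measure Ω)
    (S : ℕ → Ω → Vec k) (Y : ℕ → Ω → Vec n) (t : ℕ) (ω : Ω) : Vec k :=
  S t ω - (μ[S t | pastOutputs Y t]) ω

lemma toEuclideanLin_mul_apply {a b c : ℕ} (B : Matrix (Fin a) (Fin b) ℝ)
    (C : Matrix (Fin b) (Fin c) ℝ) (x : Vec c) :
    (B * C).toEuclideanLin x = B.toEuclideanLin (C.toEuclideanLin x) := by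
  simp [toLpLin_apply, mulVec_mulVec]

lemma toEuclideanLin_one_apply {a : ℕ} (x : Vec a) :
    (1 : Matrix (Fin a) (Fin a) ℝ).toEuclideanLin x = x := by
  simp

lemma integrable_of_hasLaw_gaussian {Ω : Type*} [MeasurableSpace Ω] {μ : Measure Ω} {a : ℕ}
    {P : Matrix (Fin a) (Fin a) ℝ} {X : Ω → Vec a} (hX : HasLaw X (multivariateGaussian 0 P) μ) :
    Integrable X μ :=
  hX.hasGaussianLaw.integrable

lemma integral_of_hasLaw_gaussian {Ω : Type*} [MeasurableSpace Ω] {μ : Measure Ω} {a : ℕ}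
    {P : Matrix (Fin a) (Fin a) ℝ} {X : Ω → Vec a} (hX : HasLaw X (multivariateGaussian 0 P) μ) :
    ∫ ω, X ω ∂μ = 0 := by
  rw [← integral_id_multivariateGaussian (μ := (0 : Vec a)) (S := P), ← hX.map_eq,
    integral_map hX.aemeasurable (by fun_prop)]

/-- One step of the Kalman filter. The state `s = ŝ + e`, whose prediction error `e` is Gaussian and
independent of the past `𝓖`, is measured by `y = G e + N` and then evolves to `A s + w`. The error
of the next prediction is again Gaussian and independent of the enlarged past. -/
theorem kalman_step {k n : ℕ} {Ω : Type} {𝓖 𝓖' mP mN mW mΩ : MeasurableSpace Ω} {μ : Measure Ω}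
    [IsProbabilityMeasure μ] {A P Q : Matrix (Fin k) (Fin k) ℝ} {G : Matrix (Fin n) (Fin k) ℝ}
    {R : Matrix (Fin n) (Fin n) ℝ} (hP : P.PosSemidef) (hQ : Q.PosSemidef) (hR : R.PosDef)
    {s s' sHat e w : Ω → Vec k} {y N : Ω → Vec n}
    (hmP : mP ≤ mΩ) (hmN : mN ≤ mΩ) (hmW : mW ≤ mΩ) (h𝓖 : 𝓖 ≤ mP)
    (hPN : Indep mP mN μ) (hPNW : Indep (mP ⊔ mN) mW μ)
    (hem : Measurable[mP] e) (hNm : Measurable[mN] N) (hwm : Measurable[mW] w)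
    (hsm : StronglyMeasurable[𝓖] sHat) (hsint : Integrable sHat μ)
    (he : HasLaw e (multivariateGaussian 0 P) μ) (hN : HasLaw N (multivariateGaussian 0 R) μ)
    (hw : HasLaw w (multivariateGaussian 0 Q) μ)
    (he𝓖 : Indep (MeasurableSpace.comap e inferInstance) 𝓖 μ)
    (hs : ∀ ω, s ω = sHat ω + e ω) (hy : ∀ ω, y ω = G.toEuclideanLin (e ω) + N ω)
    (hs' : ∀ ω, s' ω = A.toEuclideanLin (s ω) + w ω)
    (h𝓖' : MeasurableSpace.comap y inferInstance ⊔ 𝓖 = 𝓖') :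
    HasLaw (fun ω => s' ω - (μ[s' | 𝓖']) ω)
      (multivariateGaussian 0 (A * updateCov P G R (kalmanGain P G R) * Aᵀ + Q)) μ ∧
    Indep (MeasurableSpace.comap (fun ω => s' ω - (μ[s' | 𝓖']) ω) inferInstance) 𝓖' μ := by
  generalize hK : kalmanGain P G R = K
  have heP : MeasurableSpace.comap e inferInstance ≤ mP := hem.comap_le
  have hpair : Indep 𝓖 (MeasurableSpace.comap e inferInstance ⊔ mN) μ :=
    indep_sup_right_of_indep_sup_left (h𝓖.trans hmP) (heP.trans hmP) hmN he𝓖.symm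
      (indep_of_indep_of_le_left hPN (sup_le h𝓖 heP))
  have heN : IndepFun e N μ := by
    rw [IndepFun_iff_Indep]
    exact indep_of_indep_of_le hPN heP hNm.comap_le
  have hyeq : y = fun ω => G.toEuclideanLin (e ω) +
      (1 : Matrix (Fin n) (Fin n) ℝ).toEuclideanLin (N ω) :=
    funext fun ω => by rw [toEuclideanLin_one_apply]; exact hy ω
  -- `f` is the error of the updated estimate `sHat + K y`
  obtain ⟨f, hf⟩ : ∃ f : Ω → Vec k, f =
      fun ω => (1 - K * G).toEuclideanLin (e ω) + (-K).toEuclideanLin (N ω) := ⟨_, rfl⟩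
  have hfy : IndepFun f y μ := by
    rw [hyeq, hf]
    refine indepFun_gaussian_of_uncorrelated hP hR.posSemidef he hN heN _ _ _ _ ?_
    rw [← hK, kalmanGain_orthogonality hP G hR, transpose_one, Matrix.mul_one, Matrix.neg_mul,
      add_neg_cancel]
  have hflaw : HasLaw f (multivariateGaussian 0 (updateCov P G R K)) μ := by
    have := hasLaw_gaussian_add hP hR.posSemidef he hN heN (1 - K * G) (-K)
    rw [transpose_neg, Matrix.mul_neg, Matrix.neg_mul, Matrix.neg_mul, neg_neg] at this
    rw [hf]
    exact this
  have hylaw := hasLaw_gaussian_add hP hR.posSemidef he hN heN G 1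
  rw [← hyeq] at hylaw
  have hem' : Measurable[MeasurableSpace.comap e inferInstance ⊔ mN] e :=
    (comap_measurable e).mono le_sup_left le_rfl
  have hNm' : Measurable[MeasurableSpace.comap e inferInstance ⊔ mN] N :=
    hNm.mono le_sup_right le_rfl
  have hfm : Measurable[MeasurableSpace.comap e inferInstance ⊔ mN] f := by
    rw [hf]
    exact ((measurable_toEuclideanLin _).comp hem').add ((measurable_toEuclideanLin _).comp hNm')
  have hym : Measurable[MeasurableSpace.comap e inferInstance ⊔ mN] y := by
    rw [hyeq]
    exact ((measurable_toEuclideanLin _).comp hem').add ((measurable_toEuclideanLin _).comp hNm')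
  have hle : MeasurableSpace.comap e inferInstance ⊔ mN ≤ mP ⊔ mN := sup_le_sup_right heP _
  have hPN_le : mP ⊔ mN ≤ mΩ := sup_le hmP hmN
  have hf_past : Indep (MeasurableSpace.comap f inferInstance) 𝓖' μ := by
    rw [← h𝓖']
    refine indep_sup_right_of_indep_sup_left (hfm.comap_le.trans (hle.trans hPN_le))
      (hym.comap_le.trans (hle.trans hPN_le)) (h𝓖.trans hmP)
      ((IndepFun_iff_Indep _ _ _).mp hfy) ?_
    exact indep_of_indep_of_le_left hpair.symm (sup_le hfm.comap_le hym.comap_le)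
  have hnext_le : 𝓖' ≤ mP ⊔ mN := by
    rw [← h𝓖']
    exact sup_le (hym.comap_le.trans hle) (h𝓖.trans le_sup_left)
  have hfle : MeasurableSpace.comap f inferInstance ≤ mP ⊔ mN := hfm.comap_le.trans hle
  -- `r` is the next prediction error, up to a null set
  obtain ⟨r, hr⟩ : ∃ r : Ω → Vec k, r = fun ω => A.toEuclideanLin (f ω) + w ω := ⟨_, rfl⟩
  have hfw : IndepFun f w μ := by
    rw [IndepFun_iff_Indep]
    exact indep_of_indep_of_le hPNW hfle hwm.comap_le
  have hrlaw : HasLaw r (multivariateGaussian 0 (A * updateCov P G R K * Aᵀ + Q)) μ := by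
    have := hasLaw_gaussian_add (posSemidef_updateCov hP G hR.posSemidef K) hQ hflaw hw hfw A 1
    simp only [toEuclideanLin_one_apply, Matrix.mul_one, Matrix.one_mul, transpose_one] at this
    rw [hr]
    exact this
  have hfw_past : Indep 𝓖' (MeasurableSpace.comap f inferInstance ⊔ mW) μ :=
    indep_sup_right_of_indep_sup_left (hnext_le.trans hPN_le) (hfle.trans hPN_le) hmW
      hf_past.symm (indep_of_indep_of_le_left hPNW (sup_le hnext_le hfle))
  have hrm : Measurable[MeasurableSpace.comap f inferInstance ⊔ mW] r := by
    have h1 : Measurable[MeasurableSpace.comap f inferInstance ⊔ mW] f :=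
      (comap_measurable f).mono le_sup_left le_rfl
    rw [hr]
    exact ((measurable_toEuclideanLin A).comp h1).add (hwm.mono le_sup_right le_rfl)
  have hr_past : Indep (MeasurableSpace.comap r inferInstance) 𝓖' μ :=
    (indep_of_indep_of_le_right hfw_past hrm.comap_le).symm
  -- `a` is the part of the next state that the outputs determine
  obtain ⟨a, ha⟩ : ∃ a : Ω → Vec k, a =
      fun ω => A.toEuclideanLin (sHat ω + K.toEuclideanLin (y ω)) := ⟨_, rfl⟩
  have hsplit : s' = a + r := by
    funext ω
    rw [hs', Pi.add_apply, ha, hr, hf]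
    simp only
    rw [← add_assoc, ← map_add]
    congr 2
    rw [hs, hy]
    simp only [map_sub, map_neg, LinearMap.sub_apply, toEuclideanLin_one_apply,
      LinearMap.neg_apply, map_add, toEuclideanLin_mul_apply]
    abel
  have ha_int : Integrable a μ := by
    have h1 : Integrable (fun ω => K.toEuclideanLin (y ω)) μ :=
      (LinearMap.toContinuousLinearMap K.toEuclideanLin).integrable_comp
        (integrable_of_hasLaw_gaussian hylaw)
    rw [ha]
    exact (LinearMap.toContinuousLinearMap A.toEuclideanLin).integrable_comp (hsint.add h1)
  have hr_int : Integrable r μ := integrable_of_hasLaw_gaussian hrlaw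
  have hpast_le : 𝓖' ≤ mΩ := hnext_le.trans hPN_le
  have ha_meas : StronglyMeasurable[𝓖'] a := by
    have h1 : Measurable[𝓖'] sHat := hsm.measurable.mono (h𝓖' ▸ le_sup_right) le_rfl
    have h2 : Measurable[𝓖'] y := (comap_measurable y).mono (h𝓖' ▸ le_sup_left) le_rfl
    rw [ha]
    exact Measurable.stronglyMeasurable ((measurable_toEuclideanLin A).comp
      (h1.add ((measurable_toEuclideanLin K).comp h2)))
  have hrm' : Measurable r := hrm.mono (sup_le (hfle.trans hPN_le) hmW) le_rfl
  have hcond : μ[s' | 𝓖'] =ᵐ[μ] a := by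
    rw [hsplit]
    have h1 := condExp_add ha_int hr_int 𝓖'
    have h2 := condExp_of_stronglyMeasurable hpast_le ha_meas ha_int
    have h3 := condExp_indep_eq hrm'.comap_le hpast_le
      (comap_measurable r).stronglyMeasurable hr_past
    filter_upwards [h1, h3] with ω hω1 hω3
    rw [hω1, Pi.add_apply, h2, hω3, integral_of_hasLaw_gaussian hrlaw, add_zero]
  have hae : (fun ω => s' ω - (μ[s' | 𝓖']) ω) =ᵐ[μ] r := by
    filter_upwards [hcond] with ω hω
    rw [hω, hsplit, Pi.add_apply, add_sub_cancel_left]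
  refine ⟨hrlaw.congr hae, ?_⟩
  have key : @IndepFun Ω (Vec k) Ω mΩ inferInstance 𝓖' r id μ :=
    (@IndepFun_iff_Indep Ω (Vec k) Ω mΩ inferInstance 𝓖' r id μ).mpr
      (by rw [MeasurableSpace.comap_id]; exact hr_past)
  have key2 := (@IndepFun_iff_Indep Ω (Vec k) Ω mΩ inferInstance 𝓖' _ id μ).mp
    (IndepFun.congr key hae.symm EventuallyEq.rfl)
  rwa [MeasurableSpace.comap_id] at key2

namespace IsRealization

variable {k n : ℕ} {A Q : Matrix (Fin k) (Fin k) ℝ} {h : Fin n → ℝ}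
    {Γ : Matrix (Fin n) (Fin k) ℝ} {Sig : Matrix (Fin n) (Fin n) ℝ}
    {Ω : Type} {mΩ : MeasurableSpace Ω} {μ : Measure Ω}
    {S W : ℕ → Ω → Vec k} {Z M X Y : ℕ → Ω → Vec n}

variable (hr : IsRealization A Q h Γ Sig μ S W Z M X Y)

include hr

lemma measurable_predictionError_past (t : ℕ) :
    Measurable[noiseSigma (S 0) W Z M (NoiseIdx.past t)] (predictionError μ S Y t) :=
  (hr.measurable_state_past t).sub
    (stronglyMeasurable_condExp.measurable.mono (hr.pastOutputs_le_past t) le_rfl)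

lemma measurable_predictionError (t : ℕ) : Measurable (predictionError μ S Y t) :=
  (hr.measurable_predictionError_past t).mono (hr.noiseSigma_le _) le_rfl

lemma output_eq (t : ℕ) (ω : Ω) :
    Y t ω = (diagonal h * Γ).toEuclideanLin (predictionError μ S Y t ω)
      + ((diagonal h).toEuclideanLin (M t ω) + Z t ω) := by
  rw [hr.channel, hr.encoder, map_add, toEuclideanLin_mul_apply, add_assoc]
  rfl

omit hr in
lemma pastOutputs_zero : pastOutputs Y 0 = ⊥ := iSup_of_empty _

lemma hasLaw_outputNoise [IsProbabilityMeasure μ] (hSig : Sig.PosSemidef) (t : ℕ) :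
    HasLaw (fun ω => (diagonal h).toEuclideanLin (M t ω) + Z t ω)
      (multivariateGaussian 0 (outputNoiseCov h Sig)) μ := by
  have hind : IndepFun (M t) (Z t) μ :=
    hr.indep.indepFun (i := .encoder t) (j := .channel t) (by simp)
  have := hasLaw_gaussian_add hSig .one (hr.law_encoder t) (hr.law_channel t) hind (diagonal h) 1
  simpa only [toEuclideanLin_one_apply, Matrix.mul_one, transpose_one, outputNoiseCov] using this

/-- The Kalman filter: the prediction error is Gaussian, its covariance follows the Riccati
recursion, and it is independent of the past channel outputs. -/
theorem hasLaw_predictionError [IsProbabilityMeasure μ] (hQ : Q.PosSemidef)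
    (hSig : Sig.PosSemidef) (t : ℕ) :
    HasLaw (predictionError μ S Y t) (multivariateGaussian 0
      (errorCov A Q (diagonal h * Γ) (outputNoiseCov h Sig) t)) μ ∧
    Indep (MeasurableSpace.comap (predictionError μ S Y t) inferInstance) (pastOutputs Y t) μ := by
  induction t with
  | zero =>
    have h0 : pastOutputs Y 0 = ⊥ := pastOutputs_zero
    refine ⟨?_, h0 ▸ indep_bot_right _⟩
    have : predictionError μ S Y 0 = S 0 := by
      funext ω
      rw [predictionError, h0, condExp_bot, integral_of_hasLaw_gaussian hr.law_init, sub_zero]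
    rw [this]
    exact hr.law_init
  | succ t ih =>
    have hR : (outputNoiseCov h Sig).PosDef := posDef_outputNoiseCov h hSig
    have hM : Measurable[noiseSigma (S 0) W Z M {.channel t, .encoder t}] (M t) :=
      measurable_noiseSigma (i := .encoder t) (by simp)
    have hZ : Measurable[noiseSigma (S 0) W Z M {.channel t, .encoder t}] (Z t) :=
      measurable_noiseSigma (i := .channel t) (by simp)
    have hW : Measurable[noiseSigma (S 0) W Z M {.process t}] (W t) :=
      measurable_noiseSigma (i := .process t) (by simp)
    have hd1 : Disjoint (NoiseIdx.past t) {.channel t, .encoder t} := by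
      rw [Set.disjoint_right]
      rintro i (rfl | rfl) hi
      exacts [NoiseIdx.channel_notMem_past t hi, NoiseIdx.encoder_notMem_past t hi]
    have hd2 : Disjoint (NoiseIdx.past t ∪ {.channel t, .encoder t}) {.process t} := by
      rw [Set.disjoint_singleton_right]
      rintro (hi | hi | hi)
      · exact NoiseIdx.process_notMem_past t hi
      · cases hi
      · cases hi
    have hPN := hr.indep_noiseSigma hd1
    have hPNW := indep_of_indep_of_le_left (hr.indep_noiseSigma hd2)
      (sup_le (noiseSigma_mono Set.subset_union_left) (noiseSigma_mono Set.subset_union_right))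
    have := kalman_step (posSemidef_errorCov A hQ (diagonal h * Γ) hR.posSemidef t) hQ hR
      (hr.noiseSigma_le _) (hr.noiseSigma_le _) (hr.noiseSigma_le _) (hr.pastOutputs_le_past t)
      hPN hPNW (hr.measurable_predictionError_past t)
      (((measurable_toEuclideanLin (diagonal h)).comp hM).add hZ) hW
      stronglyMeasurable_condExp integrable_condExp ih.1 (hr.hasLaw_outputNoise hSig t)
      (hr.law_process t) ih.2 (s := S t) (s' := S (t + 1))
      (fun ω => by rw [predictionError]; abel) (hr.output_eq t) (hr.source t)
      (pastOutputs_succ t).symm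
    exact this

/-- The transmitted power at time `t`. -/
lemma lintegral_enorm_sq_input [IsProbabilityMeasure μ] (hQ : Q.PosSemidef)
    (hSig : Sig.PosSemidef) (t : ℕ) :
    ∫⁻ ω, ‖X t ω‖ₑ ^ 2 ∂μ = ENNReal.ofReal
      (Γ * errorCov A Q (diagonal h * Γ) (outputNoiseCov h Sig) t * Γᵀ + Sig).trace := by
  have hP := posSemidef_errorCov A hQ (diagonal h * Γ)
    (posDef_outputNoiseCov h hSig).posSemidef t
  have hind : IndepFun (predictionError μ S Y t) (M t) μ := by
    rw [IndepFun_iff_Indep]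
    have hM : Measurable[noiseSigma (S 0) W Z M {.encoder t}] (M t) :=
      measurable_noiseSigma (i := .encoder t) (by simp)
    exact indep_of_indep_of_le (hr.indep_noiseSigma
      (Set.disjoint_singleton_right.mpr (NoiseIdx.encoder_notMem_past t)))
      (hr.measurable_predictionError_past t).comap_le hM.comap_le
  have := hasLaw_gaussian_add hP hSig (hr.hasLaw_predictionError hQ hSig t).1 (hr.law_encoder t)
    hind Γ 1
  have hX : X t = fun ω => Γ.toEuclideanLin (predictionError μ S Y t ω)
      + (1 : Matrix (Fin n) (Fin n) ℝ).toEuclideanLin (M t ω) :=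
    funext fun ω => by rw [toEuclideanLin_one_apply]; exact hr.encoder t ω
  rw [hX, lintegral_enorm_sq_gaussian ((posSemidef_conj _ hP).add (posSemidef_conj _ hSig)) this]
  simp

/-- No decoder has a smaller mean-squared error than the conditional expectation. The prediction
error `e` is symmetric and independent of the past outputs, so that `e + v` and `-e + v` have the
same law for every function `v` of these outputs. -/
lemma ofReal_trace_le_lintegral [IsProbabilityMeasure μ] (hQ : Q.PosSemidef)
    (hSig : Sig.PosSemidef) (t : ℕ) {g : (Fin t → Vec n) → Vec k} (hg : Measurable g) :
    ENNReal.ofReal (errorCov A Q (diagonal h * Γ) (outputNoiseCov h Sig) t).trace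
      ≤ ∫⁻ ω, ‖S t ω - g (fun s : Fin t => Y s ω)‖ₑ ^ 2 ∂μ := by
  have hP := posSemidef_errorCov A hQ (diagonal h * Γ)
    (posDef_outputNoiseCov h hSig).posSemidef t
  obtain ⟨hlaw, hind⟩ := hr.hasLaw_predictionError hQ hSig t
  set e := predictionError μ S Y t with he
  set v : Ω → Vec k := fun ω => (μ[S t | pastOutputs Y t]) ω - g (fun s : Fin t => Y s ω) with hv
  have hvm : Measurable[pastOutputs Y t] v := by
    have h1 : Measurable[pastOutputs Y t] (fun ω (s : Fin t) => Y s ω) :=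
      @measurable_pi_lambda _ _ _ (pastOutputs Y t) _ _ fun s => (comap_measurable _).mono
        (le_iSup (fun s : Fin t => MeasurableSpace.comap (Y s) inferInstance) s) le_rfl
    exact stronglyMeasurable_condExp.measurable.sub (hg.comp h1)
  have hvm' : Measurable v := hvm.mono (hr.pastOutputs_le t) le_rfl
  have hem := hr.measurable_predictionError t
  have hev : IndepFun e v μ := by
    rw [IndepFun_iff_Indep]
    exact indep_of_indep_of_le_right hind hvm.comap_le
  have hneg : HasLaw (fun ω => -e ω) (multivariateGaussian 0
      (errorCov A Q (diagonal h * Γ) (outputNoiseCov h Sig) t)) μ := by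
    have := hasLaw_gaussian_map hP hlaw (-1 : Matrix (Fin k) (Fin k) ℝ)
    simpa only [map_neg, LinearMap.neg_apply, toEuclideanLin_one_apply, transpose_neg,
      transpose_one, Matrix.mul_neg, Matrix.neg_mul, neg_neg, Matrix.one_mul, Matrix.mul_one]
      using this
  have hid : IdentDistrib (fun ω => (e ω, v ω)) (fun ω => (-e ω, v ω)) μ μ :=
    IdentDistrib.prodMk ⟨hlaw.aemeasurable, hneg.aemeasurable, by rw [hlaw.map_eq, hneg.map_eq]⟩
      (IdentDistrib.refl hvm'.aemeasurable) hev
      (hev.comp (φ := fun x => -x) (ψ := id) measurable_neg measurable_id)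
  have hsym : ∫⁻ ω, ‖e ω + v ω‖ₑ ^ 2 ∂μ = ∫⁻ ω, ‖-e ω + v ω‖ₑ ^ 2 ∂μ :=
    (hid.comp (u := fun p : Vec k × Vec k => ‖p.1 + p.2‖ₑ ^ 2) (by fun_prop)).lintegral_eq
  have hpar : ∀ ω, 2 * ‖e ω‖ₑ ^ 2 ≤ ‖e ω + v ω‖ₑ ^ 2 + ‖-e ω + v ω‖ₑ ^ 2 := by
    intro ω
    have h1 := parallelogram_law_with_norm ℝ (v ω) (e ω)
    have h2 : 2 * ‖e ω‖ ^ 2 ≤ ‖e ω + v ω‖ ^ 2 + ‖-e ω + v ω‖ ^ 2 := by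
      rw [add_comm (e ω), neg_add_eq_sub]
      nlinarith [norm_nonneg (v ω)]
    simp only [← ofReal_norm]
    rw [← ENNReal.ofReal_pow (norm_nonneg _), ← ENNReal.ofReal_pow (norm_nonneg _),
      ← ENNReal.ofReal_pow (norm_nonneg _), ← ENNReal.ofReal_add (by positivity) (by positivity),
      show (2 : ℝ≥0∞) * ENNReal.ofReal (‖e ω‖ ^ 2) =
        ENNReal.ofReal 2 * ENNReal.ofReal (‖e ω‖ ^ 2) by
          rw [ENNReal.ofReal_ofNat], ← ENNReal.ofReal_mul (by norm_num)]
    exact ENNReal.ofReal_le_ofReal h2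
  have h2 := lintegral_mono (μ := μ) hpar
  rw [lintegral_const_mul _ (by fun_prop), lintegral_add_left (by fun_prop), ← hsym, ← two_mul,
    ENNReal.mul_le_mul_iff_right (by norm_num) (by norm_num)] at h2
  rw [← lintegral_enorm_sq_gaussian hP hlaw]
  refine h2.trans (le_of_eq (lintegral_congr fun ω => ?_))
  congr 2
  rw [he, hv, predictionError]
  simp

end IsRealization

/-! ### The optimal decoder and the existence of realizations -/

lemma pastOutputs_eq_comap {n : ℕ} {Ω : Type} (Y : ℕ → Ω → Vec n) (t : ℕ) :
    pastOutputs Y t = MeasurableSpace.comap (fun ω (s : Fin t) => Y s ω) inferInstance := by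
  simp only [pastOutputs, MeasurableSpace.pi, MeasurableSpace.comap_iSup,
    MeasurableSpace.comap_comp]
  rfl

/-- The decoder that computes the conditional expectation attains the mean-squared error given by
the Riccati recursion. -/
lemma IsRealization.exists_decoder {k n : ℕ} {A Q : Matrix (Fin k) (Fin k) ℝ} {h : Fin n → ℝ}
    {Γ : Matrix (Fin n) (Fin k) ℝ} {Sig : Matrix (Fin n) (Fin n) ℝ}
    {Ω : Type} {mΩ : MeasurableSpace Ω} {μ : Measure Ω} [IsProbabilityMeasure μ]
    {S W : ℕ → Ω → Vec k} {Z M X Y : ℕ → Ω → Vec n}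
    (hr : IsRealization A Q h Γ Sig μ S W Z M X Y) (hQ : Q.PosSemidef) (hSig : Sig.PosSemidef)
    (t : ℕ) :
    ∃ g : (Fin t → Vec n) → Vec k, Measurable g ∧
      ∫⁻ ω, ‖S t ω - g (fun s : Fin t => Y s ω)‖ₑ ^ 2 ∂μ = ENNReal.ofReal
        (errorCov A Q (diagonal h * Γ) (outputNoiseCov h Sig) t).trace := by
  have h1 : Measurable[MeasurableSpace.comap (fun ω (s : Fin t) => Y s ω) inferInstance]
      (μ[S t | pastOutputs Y t]) :=
    stronglyMeasurable_condExp.measurable.mono (pastOutputs_eq_comap Y t).le le_rfl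
  obtain ⟨g, hg, hgeq⟩ := h1.exists_eq_measurable_comp
  refine ⟨g, hg, ?_⟩
  rw [← lintegral_enorm_sq_gaussian (posSemidef_errorCov A hQ (diagonal h * Γ)
    (posDef_outputNoiseCov h hSig).posSemidef t) (hr.hasLaw_predictionError hQ hSig t).1]
  refine lintegral_congr fun ω => ?_
  rw [predictionError, hgeq]
  rfl

/-- The covariances of the primitive random vectors. -/
def noiseCov {k n : ℕ} (Q : Matrix (Fin k) (Fin k) ℝ) (Sig : Matrix (Fin n) (Fin n) ℝ) :
    (i : NoiseIdx) → Matrix (Fin (i.dim k n)) (Fin (i.dim k n)) ℝ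
  | .init => Q
  | .process _ => Q
  | .channel _ => 1
  | .encoder _ => Sig

/-- The states driven by a given realization of the noises. -/
def sourceProcess {k : ℕ} {Ω : Type} (A : Matrix (Fin k) (Fin k) ℝ) (S₀ : Ω → Vec k)
    (W : ℕ → Ω → Vec k) : ℕ → Ω → Vec k
  | 0 => S₀
  | t + 1 => fun ω => A.toEuclideanLin (sourceProcess A S₀ W t ω) + W t ω

/-- The channel outputs of the closed loop, in which each input depends on the earlier outputs
through the conditional expectation of the state. -/
def outputProcess {k n : ℕ} {Ω : Type} [MeasurableSpace Ω] (μ : Measure Ω) (h : Fin n → ℝ)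
    (Γ : Matrix (Fin n) (Fin k) ℝ) (S : ℕ → Ω → Vec k) (Z M : ℕ → Ω → Vec n) (t : ℕ) :
    Ω → Vec n := fun ω =>
  (diagonal h).toEuclideanLin (Γ.toEuclideanLin (S t ω - (μ[S t | ⨆ s : Fin t,
    MeasurableSpace.comap (outputProcess μ h Γ S Z M s) inferInstance]) ω) + M t ω) + Z t ω
termination_by t
decreasing_by exact s.2

/-- Every linear time-invariant encoder has a realization, on an infinite product space. -/
theorem exists_isRealization {k n : ℕ} (A Q : Matrix (Fin k) (Fin k) ℝ) (h : Fin n → ℝ)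
    (Γ : Matrix (Fin n) (Fin k) ℝ) (Sig : Matrix (Fin n) (Fin n) ℝ) :
    ∃ (Ω : Type) (_ : MeasurableSpace Ω) (μ : Measure Ω) (_ : IsProbabilityMeasure μ)
      (S W : ℕ → Ω → Vec k) (Z M X Y : ℕ → Ω → Vec n),
      IsRealization A Q h Γ Sig μ S W Z M X Y := by
  let P : (i : NoiseIdx) → Measure (Vec (i.dim k n)) :=
    fun i => multivariateGaussian 0 (noiseCov Q Sig i)
  let μ : Measure ((i : NoiseIdx) → Vec (i.dim k n)) := Measure.infinitePi P
  let S : ℕ → ((i : NoiseIdx) → Vec (i.dim k n)) → Vec k :=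
    sourceProcess A (fun ω => ω .init) (fun t ω => ω (.process t))
  let Z : ℕ → ((i : NoiseIdx) → Vec (i.dim k n)) → Vec n := fun t ω => ω (.channel t)
  let M : ℕ → ((i : NoiseIdx) → Vec (i.dim k n)) → Vec n := fun t ω => ω (.encoder t)
  let Y := outputProcess μ h Γ S Z M
  have hfam : noiseFamily (S 0) (fun t ω => ω (.process t)) Z M = fun i ω => ω i := by
    funext i
    cases i <;> rfl
  have hlaw : ∀ i, HasLaw (fun ω : (i : NoiseIdx) → Vec (i.dim k n) => ω i) (P i) μ :=
    fun i => (measurePreserving_eval_infinitePi P i).hasLaw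
  refine ⟨(i : NoiseIdx) → Vec (i.dim k n), inferInstance, μ, inferInstance, S,
    fun t ω => ω (.process t), Z, M,
    fun t ω => Γ.toEuclideanLin (S t ω - (μ[S t | pastOutputs Y t]) ω) + M t ω, Y, ?_⟩
  refine ⟨?_, ?_, hlaw .init, fun t => hlaw (.process t), fun t => hlaw (.channel t),
    fun t => hlaw (.encoder t), fun _ _ => rfl, ?_, fun _ _ => rfl⟩
  · rw [hfam]
    exact fun i => measurable_pi_apply i
  · rw [hfam]
    exact iIndepFun_infinitePi (X := fun i x => x) (fun i => measurable_id)
  · intro t ω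
    change outputProcess μ h Γ S Z M t ω = _
    rw [outputProcess]

/-! ### Diagonalization and observability -/

section Diagonalization

variable {k : ℕ} {A : Matrix (Fin k) (Fin k) ℝ} {lam : Fin k → ℂ}

/-- A real matrix with distinct complex eigenvalues is diagonalizable over `ℂ`. -/
lemma exists_diagonalization
    (hlam : A.charpoly.map (algebraMap ℝ ℂ) = ∏ j, (Polynomial.X - Polynomial.C (lam j)))
    (hdistinct : Function.Injective lam) :
    ∃ U : Matrix (Fin k) (Fin k) ℂ, IsUnit U ∧
      A.map (algebraMap ℝ ℂ) * U = U * diagonal lam := by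
  set B := A.map (algebraMap ℝ ℂ) with hB
  have hroot : ∀ j, ∃ v : Fin k → ℂ, v ≠ 0 ∧ B *ᵥ v = lam j • v := by
    intro j
    have h1 : B.charpoly.eval (lam j) = 0 := by
      rw [hB, charpoly_map, hlam, Polynomial.eval_prod]
      exact Finset.prod_eq_zero (Finset.mem_univ j) (by simp)
    rw [eval_charpoly] at h1
    obtain ⟨v, hv, hv0⟩ := exists_mulVec_eq_zero_iff.mpr h1
    refine ⟨v, hv, ?_⟩
    rw [sub_mulVec, sub_eq_zero] at hv0
    rw [← hv0]
    ext i
    simp [scalar_apply, mulVec_diagonal]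
  choose v hv0 hv using hroot
  have hli : LinearIndependent ℂ v := by
    refine Module.End.eigenvectors_linearIndependent' B.mulVecLin lam hdistinct v fun j => ?_
    exact ⟨Module.End.mem_eigenspace_iff.mpr (hv j), hv0 j⟩
  refine ⟨(of v)ᵀ, ?_, ?_⟩
  · rw [← linearIndependent_cols_iff_isUnit]
    exact hli
  · ext i j
    have := congrFun (hv j) i
    rw [mul_diagonal, transpose_apply, of_apply, mul_comm]
    exact this

/-- The powers of the inverse in the eigenbasis. -/
lemma inv_pow_map_mul (hA : IsUnit A.det) (hlam0 : ∀ j, lam j ≠ 0)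
    {U : Matrix (Fin k) (Fin k) ℂ} (hAU : A.map (algebraMap ℝ ℂ) * U = U * diagonal lam) (m : ℕ) :
    (A⁻¹ ^ m).map (algebraMap ℝ ℂ) * U = U * diagonal (fun j => (lam j)⁻¹ ^ m) := by
  have hmap : ∀ m : ℕ, (A⁻¹ ^ m).map (algebraMap ℝ ℂ) = (A⁻¹.map (algebraMap ℝ ℂ)) ^ m :=
    map_pow (algebraMap ℝ ℂ).mapMatrix A⁻¹
  rw [hmap]
  set C := A⁻¹.map (algebraMap ℝ ℂ) with hC
  have hCA : C * A.map (algebraMap ℝ ℂ) = 1 := by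
    rw [hC, ← Matrix.map_mul, nonsing_inv_mul _ hA, Matrix.map_one _ (map_zero _) (map_one _)]
  have hCU : C * U = U * diagonal (fun j => (lam j)⁻¹) := by
    have h1 : C * (A.map (algebraMap ℝ ℂ) * U) * diagonal (fun j => (lam j)⁻¹)
        = C * (U * diagonal lam) * diagonal (fun j => (lam j)⁻¹) := by rw [hAU]
    rw [← Matrix.mul_assoc, hCA, Matrix.one_mul, Matrix.mul_assoc, Matrix.mul_assoc,
      diagonal_mul_diagonal] at h1
    rw [h1]
    simp [mul_inv_cancel₀ (hlam0 _)]
  induction m with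
  | zero => simp
  | succ m ih =>
    rw [pow_succ, Matrix.mul_assoc, hCU, ← Matrix.mul_assoc, ih, Matrix.mul_assoc,
      diagonal_mul_diagonal]
    simp only [pow_succ]

lemma abs_det_eq_prod_norm
    (hlam : A.charpoly.map (algebraMap ℝ ℂ) = ∏ j, (Polynomial.X - Polynomial.C (lam j)))
    (hdistinct : Function.Injective lam) : |A.det| = ∏ j, ‖lam j‖ := by
  obtain ⟨U, hU, hAU⟩ := exists_diagonalization hlam hdistinct
  have h1 := congrArg Matrix.det hAU
  rw [det_mul, det_mul, mul_comm, det_diagonal] at h1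
  have h2 := mul_left_cancel₀ ((isUnit_iff_isUnit_det _).mp hU).ne_zero h1
  rw [show A.map (algebraMap ℝ ℂ) = (algebraMap ℝ ℂ).mapMatrix A from rfl,
    ← RingHom.map_det] at h2
  rw [← norm_prod, ← h2]
  simp

/-- The inverse of a matrix whose eigenvalues are distinct and outside the closed unit disc is
stable. -/
lemma tendsto_inv_pow
    (hlam : A.charpoly.map (algebraMap ℝ ℂ) = ∏ j, (Polynomial.X - Polynomial.C (lam j)))
    (hdistinct : Function.Injective lam) (hunstable : ∀ j, 1 < ‖lam j‖) (hA : IsUnit A.det) :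
    Tendsto (fun m : ℕ => A⁻¹ ^ m) atTop (nhds 0) := by
  obtain ⟨U, hU, hAU⟩ := exists_diagonalization hlam hdistinct
  have hlam0 : ∀ j, lam j ≠ 0 := fun j h0 => by
    have := hunstable j
    rw [h0, norm_zero] at this
    linarith
  have hpow : ∀ m : ℕ, (A⁻¹ ^ m).map (algebraMap ℝ ℂ)
      = U * diagonal (fun j => (lam j)⁻¹ ^ m) * U⁻¹ := by
    intro m
    rw [← inv_pow_map_mul hA hlam0 hAU, Matrix.mul_assoc,
      mul_nonsing_inv _ ((isUnit_iff_isUnit_det _).mp hU), Matrix.mul_one]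
  have hlim : Tendsto (fun m : ℕ => (A⁻¹ ^ m).map (algebraMap ℝ ℂ)) atTop (nhds 0) := by
    have hd : Tendsto (fun m : ℕ => diagonal (fun j => (lam j)⁻¹ ^ m)) atTop
        (nhds (0 : Matrix (Fin k) (Fin k) ℂ)) := by
      refine tendsto_pi_nhds.mpr fun i => tendsto_pi_nhds.mpr fun j => ?_
      by_cases hij : i = j
      · subst hij
        simp only [diagonal_apply_eq]
        exact tendsto_pow_atTop_nhds_zero_of_norm_lt_one
          (by rw [norm_inv]; exact inv_lt_one_of_one_lt₀ (hunstable i))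
      · simp [diagonal_apply_ne _ hij]
    simp only [hpow]
    have := (hd.const_mul U).mul_const U⁻¹
    simpa using this
  refine tendsto_pi_nhds.mpr fun i => tendsto_pi_nhds.mpr fun j => ?_
  have h1 : Tendsto (fun m : ℕ => (((A⁻¹ ^ m) i j : ℝ) : ℂ)) atTop (nhds 0) :=
    tendsto_pi_nhds.mp (tendsto_pi_nhds.mp hlim i) j
  have h2 := (Complex.continuous_re.tendsto _).comp h1
  simpa [Function.comp_def] using h2

/-- An observable pair: some row vector `c` is orthogonal to no eigenvector, so that a vector whose
images under the powers of `A⁻¹` are all orthogonal to `c` is zero. -/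
lemma exists_observable
    (hlam : A.charpoly.map (algebraMap ℝ ℂ) = ∏ j, (Polynomial.X - Polynomial.C (lam j)))
    (hdistinct : Function.Injective lam) (hA : IsUnit A.det) (hlam0 : ∀ j, lam j ≠ 0) :
    ∃ c : Fin k → ℝ, ∀ x : Fin k → ℝ, (∀ m : ℕ, c ⬝ᵥ (A⁻¹ ^ m) *ᵥ x = 0) → x = 0 := by
  obtain ⟨U, hU, hAU⟩ := exists_diagonalization hlam hdistinct
  have hUd := (isUnit_iff_isUnit_det _).mp hU
  -- a real point `z` of the moment curve that avoids the hyperplanes orthogonal to the columns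
  have hcol : ∀ j, ∃ i, U i j ≠ 0 := by
    intro j
    by_contra! h0
    exact hUd.ne_zero (det_eq_zero_of_column_eq_zero j h0)
  let q : Fin k → Polynomial ℂ := fun j => ∑ i : Fin k, Polynomial.monomial (i : ℕ) (U i j)
  have hq : ∀ j, q j ≠ 0 := by
    intro j h0
    obtain ⟨i, hi⟩ := hcol j
    apply hi
    have := congrArg (fun r => Polynomial.coeff r (i : ℕ)) h0
    simpa [q, Polynomial.finsetSum_coeff, Polynomial.coeff_monomial, Fin.val_inj] using this
  have hprod : ∏ j, q j ≠ 0 := Finset.prod_ne_zero_iff.mpr fun j _ => hq j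
  obtain ⟨z, hz⟩ : ∃ z : ℝ, (∏ j, q j).eval (z : ℂ) ≠ 0 := by
    by_contra! h0
    apply hprod
    refine Polynomial.eq_zero_of_infinite_isRoot _ ?_
    exact (Set.infinite_range_of_injective Complex.ofReal_injective).mono
      (by rintro _ ⟨z, rfl⟩; exact h0 z)
  rw [Polynomial.eval_prod] at hz
  have hz' : ∀ j, (q j).eval (z : ℂ) ≠ 0 := fun j =>
    Finset.prod_ne_zero_iff.mp hz j (Finset.mem_univ j)
  refine ⟨fun i => z ^ (i : ℕ), fun x hx => ?_⟩
  set cC : Fin k → ℂ := fun i => (z : ℂ) ^ (i : ℕ) with hcC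
  have hcU : ∀ j, (cC ᵥ* U) j ≠ 0 := by
    intro j
    convert hz' j using 1
    simp [q, Polynomial.eval_finsetSum, vecMul, dotProduct, hcC, mul_comm]
  set xC : Fin k → ℂ := fun i => (x i : ℂ) with hxC
  set α : Fin k → ℂ := U⁻¹ *ᵥ xC with hα
  have hxα : xC = U *ᵥ α := by
    rw [hα, mulVec_mulVec, mul_nonsing_inv _ hUd, one_mulVec]
  have hobs : ∀ m : ℕ, ∑ j, ((cC ᵥ* U) j * α j) * (lam j)⁻¹ ^ m = 0 := by
    intro m
    have h2 : cC ⬝ᵥ ((A⁻¹ ^ m).map (algebraMap ℝ ℂ)) *ᵥ xC = 0 := by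
      have h4 := congrArg (fun r : ℝ => (r : ℂ)) (hx m)
      simpa [dotProduct, mulVec, hcC, hxC] using h4
    rw [hxα, mulVec_mulVec, inv_pow_map_mul hA hlam0 hAU, ← mulVec_mulVec, dotProduct_mulVec] at h2
    rw [← h2, dotProduct]
    refine Finset.sum_congr rfl fun j _ => ?_
    rw [mulVec_diagonal]
    ring
  have hzero := eq_zero_of_forall_pow_sum_mul_pow_eq_zero
    (f := fun j => (lam j)⁻¹) (v := fun j => (cC ᵥ* U) j * α j)
    (fun i j hij => hdistinct (inv_injective hij)) (fun i => hobs i)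
  have hα0 : α = 0 := by
    funext j
    have := congrFun hzero j
    exact (mul_eq_zero.mp this).resolve_left (hcU j)
  rw [hα0, mulVec_zero] at hxα
  funext i
  have := congrFun hxα i
  simpa [hxC] using this

end Diagonalization

/-! ### The Lyapunov equation and suboptimal filters -/

section Lyapunov

variable {k n : ℕ}

lemma dotProduct_conj_mulVec (B Z : Matrix (Fin k) (Fin k) ℝ) (x : Fin k → ℝ) :
    x ⬝ᵥ (Bᵀ * Z * B) *ᵥ x = (B *ᵥ x) ⬝ᵥ Z *ᵥ (B *ᵥ x) := by
  rw [← mulVec_mulVec, ← mulVec_mulVec, dotProduct_mulVec, vecMul_transpose]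

lemma conj_iterate_eq {B Z : Matrix (Fin k) (Fin k) ℝ} (h : Z = Bᵀ * Z * B) (m : ℕ) :
    Z = (B ^ m)ᵀ * Z * B ^ m := by
  induction m with
  | zero => simp
  | succ m ih =>
    conv_lhs => rw [ih, h]
    rw [pow_succ', transpose_mul]
    simp only [Matrix.mul_assoc]

/-- The discrete Lyapunov equation of a stable matrix has a positive semidefinite solution. The map
`Z ↦ Z - Bᵀ Z B` is injective, because an element `Z` of its kernel equals `(Bᵀ)ᵐ Z Bᵐ` for all
`m`, and therefore it is surjective. -/
lemma exists_lyapunov {B T : Matrix (Fin k) (Fin k) ℝ}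
    (hB : Tendsto (fun m : ℕ => B ^ m) atTop (nhds 0)) (hT : T.PosSemidef) :
    ∃ Z : Matrix (Fin k) (Fin k) ℝ, Z.PosSemidef ∧ Z = T + Bᵀ * Z * B := by
  let Φ : Matrix (Fin k) (Fin k) ℝ →ₗ[ℝ] Matrix (Fin k) (Fin k) ℝ :=
    { toFun := fun Z => Z - Bᵀ * Z * B
      map_add' := fun Z Z' => by simp only [Matrix.mul_add, Matrix.add_mul]; abel
      map_smul' := fun r Z => by simp [smul_sub] }
  have hΦ : ∀ Z, Φ Z = Z - Bᵀ * Z * B := fun _ => rfl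
  have hinj : Function.Injective Φ := by
    rw [← LinearMap.ker_eq_bot, LinearMap.ker_eq_bot']
    intro Z hZ
    rw [hΦ, sub_eq_zero] at hZ
    have hlim : Tendsto (fun m : ℕ => (B ^ m)ᵀ * Z * B ^ m) atTop (nhds (0ᵀ * Z * 0)) :=
      (((continuous_id.matrix_transpose.tendsto _).comp hB).mul_const Z).mul hB
    have hconst : Tendsto (fun m : ℕ => (B ^ m)ᵀ * Z * B ^ m) atTop (nhds Z) := by
      simp only [← conj_iterate_eq hZ]
      exact tendsto_const_nhds
    simpa using tendsto_nhds_unique hconst hlim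
  obtain ⟨Z, hZ⟩ := LinearMap.surjective_of_injective hinj T
  have hZ' : Z = T + Bᵀ * Z * B := by rw [← hZ, hΦ]; abel
  have hTsym : Tᵀ = T := by simpa [conjTranspose_eq_transpose_of_trivial] using hT.isHermitian.eq
  have hsym : Zᵀ = Z := by
    apply hinj
    rw [hZ, hΦ, ← hTsym, ← hZ, hΦ]
    simp [transpose_sub, Matrix.mul_assoc]
  refine ⟨Z, .of_dotProduct_mulVec_nonneg
    (by rw [IsHermitian, conjTranspose_eq_transpose_of_trivial, hsym]) fun x => ?_, hZ'⟩
  have hstep : ∀ y : Fin k → ℝ, (B *ᵥ y) ⬝ᵥ Z *ᵥ (B *ᵥ y) ≤ y ⬝ᵥ Z *ᵥ y := by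
    intro y
    have h1 := hT.dotProduct_mulVec_nonneg y
    have h2 : y ⬝ᵥ Z *ᵥ y = y ⬝ᵥ T *ᵥ y + (B *ᵥ y) ⬝ᵥ Z *ᵥ (B *ᵥ y) := by
      conv_lhs => rw [hZ', add_mulVec, dotProduct_add, dotProduct_conj_mulVec]
    rw [star_trivial] at h1
    linarith
  have hiter : ∀ m : ℕ, (B ^ m *ᵥ x) ⬝ᵥ Z *ᵥ (B ^ m *ᵥ x) ≤ x ⬝ᵥ Z *ᵥ x := by
    intro m
    induction m with
    | zero => simp
    | succ m ih =>
      rw [pow_succ', ← mulVec_mulVec]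
      exact (hstep _).trans ih
  have hlim : Tendsto (fun m : ℕ => (B ^ m *ᵥ x) ⬝ᵥ Z *ᵥ (B ^ m *ᵥ x)) atTop (nhds 0) := by
    have hc : Continuous fun C : Matrix (Fin k) (Fin k) ℝ => (C *ᵥ x) ⬝ᵥ Z *ᵥ (C *ᵥ x) := by
      fun_prop
    have := (hc.tendsto 0).comp hB
    simpa [Function.comp_def] using this
  rw [star_trivial]
  exact le_of_tendsto' hlim hiter

lemma lyapunov_kernel {B T Z : Matrix (Fin k) (Fin k) ℝ} (hT : T.PosSemidef) (hZ : Z.PosSemidef)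
    (h : Z = T + Bᵀ * Z * B) {x : Fin k → ℝ} (hx : x ⬝ᵥ Z *ᵥ x = 0) (m : ℕ) :
    (B ^ m *ᵥ x) ⬝ᵥ T *ᵥ (B ^ m *ᵥ x) = 0 := by
  have key : ∀ y : Fin k → ℝ, y ⬝ᵥ Z *ᵥ y = 0 →
      y ⬝ᵥ T *ᵥ y = 0 ∧ (B *ᵥ y) ⬝ᵥ Z *ᵥ (B *ᵥ y) = 0 := by
    intro y hy
    have h1 := hT.dotProduct_mulVec_nonneg y
    have h3 := hZ.dotProduct_mulVec_nonneg (B *ᵥ y)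
    have h2 : y ⬝ᵥ Z *ᵥ y = y ⬝ᵥ T *ᵥ y + (B *ᵥ y) ⬝ᵥ Z *ᵥ (B *ᵥ y) := by
      conv_lhs => rw [h, add_mulVec, dotProduct_add, dotProduct_conj_mulVec]
    rw [star_trivial] at h1 h3
    constructor <;> linarith
  have hiter : ∀ m : ℕ, (B ^ m *ᵥ x) ⬝ᵥ Z *ᵥ (B ^ m *ᵥ x) = 0 := by
    intro m
    induction m with
    | zero => simpa using hx
    | succ m ih =>
      rw [pow_succ', ← mulVec_mulVec]
      exact (key _ ih).2
  exact (key _ (hiter m)).1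

lemma dotProduct_vecMulVec_self (c x : Fin k → ℝ) : x ⬝ᵥ (vecMulVec c c) *ᵥ x = (c ⬝ᵥ x) ^ 2 := by
  rw [vecMulVec_mulVec, dotProduct_smul]
  simp [dotProduct_comm x c, sq]

lemma posSemidef_vecMulVec (c : Fin k → ℝ) : (vecMulVec c c).PosSemidef := by
  simpa using posSemidef_vecMulVec_self_star c

/-- The Gramian of an observable pair: the inverse `X` of the limiting error covariance in the
absence of process noise. -/
lemma exists_gramian {A : Matrix (Fin k) (Fin k) ℝ} (hA : IsUnit A.det)
    (hAinv : Tendsto (fun m : ℕ => A⁻¹ ^ m) atTop (nhds 0)) {c : Fin k → ℝ}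
    (hc : ∀ x : Fin k → ℝ, (∀ m : ℕ, c ⬝ᵥ (A⁻¹ ^ m) *ᵥ x = 0) → x = 0) :
    ∃ X : Matrix (Fin k) (Fin k) ℝ, X.PosDef ∧ Aᵀ * X * A = X + vecMulVec c c := by
  have hT : ((A⁻¹)ᵀ * vecMulVec c c * A⁻¹).PosSemidef := by
    simpa using posSemidef_conj (A⁻¹)ᵀ (posSemidef_vecMulVec c)
  obtain ⟨X, hX, hXeq⟩ := exists_lyapunov hAinv hT
  refine ⟨X, ?_, ?_⟩
  · refine .of_dotProduct_mulVec_pos hX.isHermitian fun x hx => ?_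
    refine lt_of_le_of_ne (hX.dotProduct_mulVec_nonneg x) fun h0 => hx ?_
    rw [star_trivial] at h0
    have h1 := lyapunov_kernel hT hX hXeq h0.symm
    have h2 : ∀ m : ℕ, c ⬝ᵥ (A⁻¹ ^ m) *ᵥ (A⁻¹ *ᵥ x) = 0 := by
      intro m
      have := h1 m
      rw [dotProduct_conj_mulVec, dotProduct_vecMulVec_self, mulVec_mulVec, ← pow_succ',
        pow_succ A⁻¹ m, ← mulVec_mulVec] at this
      exact pow_eq_zero_iff (two_ne_zero) |>.mp this
    have h3 := congrArg (A *ᵥ ·) (hc _ h2)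
    simpa [mulVec_mulVec, mul_nonsing_inv _ hA] using h3
  · conv_lhs => rw [hXeq]
    rw [Matrix.mul_add, Matrix.add_mul, add_comm]
    have e1 : Aᵀ * (A⁻¹)ᵀ = 1 := by rw [← transpose_mul, nonsing_inv_mul _ hA, transpose_one]
    have e2 := nonsing_inv_mul _ hA
    have h1 : ∀ V : Matrix (Fin k) (Fin k) ℝ, Aᵀ * ((A⁻¹)ᵀ * V * A⁻¹) * A = V := by
      intro V
      rw [Matrix.mul_assoc (A⁻¹)ᵀ, ← Matrix.mul_assoc, e1, Matrix.one_mul, Matrix.mul_assoc, e2,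
        Matrix.mul_one]
    rw [h1, h1]

lemma updateCov_expand (P : Matrix (Fin k) (Fin k) ℝ) (G : Matrix (Fin n) (Fin k) ℝ)
    (R : Matrix (Fin n) (Fin n) ℝ) (K : Matrix (Fin k) (Fin n) ℝ) :
    updateCov P G R K =
      P - K * (G * P) - P * Gᵀ * Kᵀ + K * (G * P * Gᵀ + R) * Kᵀ := by
  simp only [updateCov, transpose_sub, transpose_mul, transpose_one, Matrix.sub_mul, Matrix.mul_sub,
    Matrix.one_mul, Matrix.mul_one, Matrix.mul_add, Matrix.add_mul, Matrix.mul_assoc]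
  abel

/-- With the Kalman gain, the updated covariance is `(1 - K G) P`. -/
lemma updateCov_kalmanGain {P : Matrix (Fin k) (Fin k) ℝ} (hP : P.PosSemidef)
    (G : Matrix (Fin n) (Fin k) ℝ) {R : Matrix (Fin n) (Fin n) ℝ} (hR : R.PosDef) :
    updateCov P G R (kalmanGain P G R) = (1 - kalmanGain P G R * G) * P := by
  rw [updateCov_expand, kalmanGain_mul hP G hR, Matrix.sub_mul, Matrix.one_mul]
  simp only [Matrix.mul_assoc]
  abel

/-- The Kalman gain minimizes the updated covariance. -/
lemma updateCov_sub_kalmanGain {P : Matrix (Fin k) (Fin k) ℝ} (hP : P.PosSemidef)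
    (G : Matrix (Fin n) (Fin k) ℝ) {R : Matrix (Fin n) (Fin n) ℝ} (hR : R.PosDef)
    (L : Matrix (Fin k) (Fin n) ℝ) :
    (updateCov P G R L - updateCov P G R (kalmanGain P G R)).PosSemidef := by
  have hV := posDef_innovationCov hP G hR
  have h1 := kalmanGain_mul hP G hR
  have hPs : Pᵀ = P := by simpa [conjTranspose_eq_transpose_of_trivial] using hP.isHermitian.eq
  have hVs : (G * P * Gᵀ + R)ᵀ = G * P * Gᵀ + R := by
    simpa [conjTranspose_eq_transpose_of_trivial] using hV.isHermitian.eq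
  have h2 : (G * P * Gᵀ + R) * (kalmanGain P G R)ᵀ = G * P := by
    have := congrArg transpose h1
    rwa [transpose_mul, hVs, transpose_mul, transpose_transpose, hPs] at this
  have expand : ∀ (K : Matrix (Fin k) (Fin n) ℝ) (V : Matrix (Fin n) (Fin n) ℝ),
      (L - K) * V * (L - K)ᵀ = L * V * Lᵀ - L * (V * Kᵀ) - K * V * Lᵀ + K * (V * Kᵀ) := by
    intro K V
    simp only [transpose_sub, Matrix.sub_mul, Matrix.mul_sub, Matrix.mul_assoc]
    abel
  have : updateCov P G R L - updateCov P G R (kalmanGain P G R)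
      = (L - kalmanGain P G R) * (G * P * Gᵀ + R) * (L - kalmanGain P G R)ᵀ := by
    rw [expand, h1, h2, updateCov_kalmanGain hP G hR, updateCov_expand, Matrix.sub_mul,
      Matrix.one_mul, Matrix.mul_assoc _ G P]
    abel
  rw [this]
  exact posSemidef_conj _ hV.posSemidef

/-- A covariance that some suboptimal filter does not increase bounds the optimal error
covariance at all times. -/
lemma posSemidef_sub_errorCov {A Q : Matrix (Fin k) (Fin k) ℝ} (hQ : Q.PosSemidef)
    {G : Matrix (Fin n) (Fin k) ℝ} {R : Matrix (Fin n) (Fin n) ℝ} (hR : R.PosDef)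
    {B : Matrix (Fin k) (Fin k) ℝ} (L : Matrix (Fin k) (Fin n) ℝ) (h0 : (B - Q).PosSemidef)
    (hstep : A * updateCov B G R L * Aᵀ + Q = B) (t : ℕ) :
    (B - errorCov A Q G R t).PosSemidef := by
  induction t with
  | zero => exact h0
  | succ t ih =>
    have hP := posSemidef_errorCov A hQ G hR.posSemidef t
    have h1 := updateCov_sub_kalmanGain hP G hR L
    have h2 : (updateCov B G R L - updateCov (errorCov A Q G R t) G R L).PosSemidef := by
      have := posSemidef_conj (1 - L * G) ih
      rw [Matrix.mul_sub, Matrix.sub_mul] at this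
      simpa [updateCov] using this
    have h3 := posSemidef_conj A (h2.add h1)
    have : B - errorCov A Q G R (t + 1)
        = A * (updateCov B G R L - updateCov (errorCov A Q G R t) G R L
          + (updateCov (errorCov A Q G R t) G R L - updateCov (errorCov A Q G R t) G R
              (kalmanGain (errorCov A Q G R t) G R))) * Aᵀ := by
      conv_lhs => rw [← hstep, errorCov]
      rw [sub_add_sub_cancel, Matrix.mul_sub, Matrix.sub_mul]
      abel
    rw [this]
    exact h3

end Lyapunov

/-! ### Achievability -/

section Achievability

variable {k n : ℕ}

lemma longTermAverage_le_of_forall_le {u : ℕ → ℝ≥0∞} {b : ℝ≥0∞} (hu : ∀ t, u t ≤ b) :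
    longTermAverage u ≤ b := by
  refine limsup_le_of_le (by isBoundedDefault) (.of_forall fun T => ?_)
  refine ENNReal.div_le_of_le_mul ?_
  calc ∑ t ∈ Finset.Icc 1 T, u t ≤ ∑ _t ∈ Finset.Icc 1 T, b := Finset.sum_le_sum fun t _ => hu t
    _ = b * T := by simp [mul_comm]

/-- In the absence of process noise, the covariance `X⁻¹` given by the Gramian is a fixed point of
the Riccati recursion. -/
lemma riccati_gramian {A X : Matrix (Fin k) (Fin k) ℝ} (hA : IsUnit A.det) (hX : X.PosDef)
    {G : Matrix (Fin n) (Fin k) ℝ} (hXA : Aᵀ * X * A = X + Gᵀ * G) :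
    A * updateCov X⁻¹ G 1 (kalmanGain X⁻¹ G 1) * Aᵀ = X⁻¹ := by
  have hXu : IsUnit X.det := (isUnit_iff_isUnit_det _).mp hX.isUnit
  have hK := kalmanGain_mul hX.inv.posSemidef G .one
  rw [updateCov_kalmanGain hX.inv.posSemidef G .one]
  generalize kalmanGain X⁻¹ G 1 = K at hK ⊢
  have h1 : (1 - K * G) * X⁻¹ * (Aᵀ * X * A) = 1 := by
    have h2 : K * (G * (X⁻¹ * (Gᵀ * G))) + K * G = X⁻¹ * (Gᵀ * G) := by
      have := congrArg (· * G) hK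
      simpa only [Matrix.mul_add, Matrix.add_mul, Matrix.mul_assoc, Matrix.mul_one] using this
    rw [hXA, Matrix.mul_assoc, Matrix.mul_add, nonsing_inv_mul _ hXu, Matrix.mul_add,
      Matrix.mul_one, Matrix.sub_mul, Matrix.one_mul, Matrix.mul_assoc,
      sub_eq_of_eq_add' h2.symm, sub_add_cancel]
  have h3 : A * ((1 - K * G) * X⁻¹) * Aᵀ * X = 1 := by
    have := congrArg (fun V => A * V * A⁻¹) h1
    simp only [Matrix.mul_one, mul_nonsing_inv _ hA] at this
    refine Eq.trans ?_ this
    simp only [Matrix.mul_assoc, mul_nonsing_inv _ hA, Matrix.mul_one]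
  exact (inv_eq_left_inv h3).symm

/-- The error of the filter designed for zero process noise stays bounded in the presence of process
noise: its closed-loop matrix is similar to the transpose of `A⁻¹`. -/
lemma exists_processNoise_cov {A X Q : Matrix (Fin k) (Fin k) ℝ} (hA : IsUnit A.det)
    (hAinv : Tendsto (fun m : ℕ => A⁻¹ ^ m) atTop (nhds 0)) (hX : X.PosDef) (hQ : Q.PosSemidef)
    {G : Matrix (Fin n) (Fin k) ℝ} (hXA : Aᵀ * X * A = X + Gᵀ * G) :
    ∃ N : Matrix (Fin k) (Fin k) ℝ, N.PosSemidef ∧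
      A * ((1 - kalmanGain X⁻¹ G 1 * G) * N * (1 - kalmanGain X⁻¹ G 1 * G)ᵀ) * Aᵀ + Q = N := by
  have hXu : IsUnit X.det := (isUnit_iff_isUnit_det _).mp hX.isUnit
  have hric := riccati_gramian hA hX hXA
  rw [updateCov_kalmanGain hX.inv.posSemidef G .one] at hric
  generalize kalmanGain X⁻¹ G 1 = K at hric ⊢
  have hAt : Aᵀ * (A⁻¹)ᵀ = 1 := by rw [← transpose_mul, nonsing_inv_mul _ hA, transpose_one]
  have hXs : Xᵀ = X := by simpa [conjTranspose_eq_transpose_of_trivial] using hX.isHermitian.eq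
  have hF : A * (1 - K * G) = X⁻¹ * (A⁻¹)ᵀ * X := by
    have := congrArg (fun V => V * (A⁻¹)ᵀ * X) hric
    rw [← this]
    simp only [Matrix.mul_assoc]
    rw [← Matrix.mul_assoc Aᵀ, hAt, Matrix.one_mul, nonsing_inv_mul _ hXu, Matrix.mul_one]
  have hFt : (A * (1 - K * G))ᵀ = X * A⁻¹ * X⁻¹ := by
    rw [hF, transpose_mul, transpose_mul, transpose_transpose, transpose_nonsing_inv, hXs,
      Matrix.mul_assoc]
  have hpow : ∀ m : ℕ, (A * (1 - K * G))ᵀ ^ m = X * A⁻¹ ^ m * X⁻¹ := by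
    intro m
    rw [hFt]
    induction m with
    | zero => rw [pow_zero, pow_zero, Matrix.mul_one, mul_nonsing_inv _ hXu]
    | succ m ih =>
      rw [pow_succ, ih, pow_succ]
      simp only [Matrix.mul_assoc]
      rw [← Matrix.mul_assoc X⁻¹ X, nonsing_inv_mul _ hXu, Matrix.one_mul]
  have hlim : Tendsto (fun m : ℕ => (A * (1 - K * G))ᵀ ^ m) atTop (nhds 0) := by
    simp only [hpow]
    have := (hAinv.const_mul X).mul_const X⁻¹
    simpa using this
  obtain ⟨N, hN, hNeq⟩ := exists_lyapunov hlim hQ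
  refine ⟨N, hN, ?_⟩
  conv_rhs => rw [hNeq]
  rw [transpose_transpose, transpose_mul]
  simp only [Matrix.mul_assoc]
  rw [add_comm]

/-- The stationary innovation power is determined by the unstable eigenvalues alone. -/
lemma one_add_trace_gramian {A X : Matrix (Fin k) (Fin k) ℝ} (hX : X.PosDef) {c : Fin k → ℝ}
    (hXA : Aᵀ * X * A = X + vecMulVec c c) :
    1 + (X⁻¹ * vecMulVec c c).trace = A.det ^ 2 := by
  have hXu : IsUnit X.det := (isUnit_iff_isUnit_det _).mp hX.isUnit
  have h1 := congrArg det hXA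
  have h2 : X + vecMulVec c c = X * (1 + X⁻¹ * vecMulVec c c) := by
    rw [Matrix.mul_add, Matrix.mul_one, ← Matrix.mul_assoc, mul_nonsing_inv _ hXu, Matrix.one_mul]
  rw [h2, det_mul, det_mul, det_mul, det_transpose, mul_vecMulVec,
    vecMulVec_eq Unit, det_one_add_replicateCol_mul_replicateRow] at h1
  have h3 : X.det * (A.det ^ 2) = X.det * (1 + c ⬝ᵥ X⁻¹ *ᵥ c) := by rw [← h1]; ring
  rw [mul_left_cancel₀ hXu.ne_zero h3, mul_vecMulVec, trace_vecMulVec, dotProduct_comm]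

/-- The gains of an encoder that uses a single sub-channel. -/
lemma exists_singleRow (i₀ : Fin n) (c : Fin k → ℝ) : ∃ G : Matrix (Fin n) (Fin k) ℝ,
    Gᵀ * G = vecMulVec c c ∧ ∀ i, i ≠ i₀ → ∀ j, G i j = 0 := by
  refine ⟨vecMulVec (Pi.single i₀ 1) c, ?_, fun i hi j => by simp [vecMulVec_apply, hi]⟩
  rw [transpose_vecMulVec, vecMulVec_mul_vecMulVec]
  simp

/-- If the sub-channel `i₀` has enough capacity at power `p`, the encoder that sends a small
multiple of an observable combination of the prediction errors over it achieves finite error. -/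
theorem finiteMSEAchievable_of_det_sq_lt {A Q : Matrix (Fin k) (Fin k) ℝ} (hQ : Q.PosDef)
    {lam : Fin k → ℂ}
    (hlam : A.charpoly.map (algebraMap ℝ ℂ) = ∏ j, (Polynomial.X - Polynomial.C (lam j)))
    (hdistinct : Function.Injective lam) (hunstable : ∀ j, 1 < ‖lam j‖)
    {h : Fin n → ℝ} {p : ℝ} (i₀ : Fin n) (hdet : A.det ^ 2 < 1 + h i₀ ^ 2 * p) :
    FiniteMSEAchievable A Q h p := by
  have hQs := hQ.posSemidef
  have habs : 1 ≤ |A.det| := by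
    rw [abs_det_eq_prod_norm hlam hdistinct]
    exact Finset.prod_induction _ (fun x : ℝ => 1 ≤ x)
      (fun _ _ => one_le_mul_of_one_le_of_one_le) le_rfl (fun j _ => (hunstable j).le)
  have hA : IsUnit A.det := by
    rw [isUnit_iff_ne_zero]
    intro h0
    rw [h0, abs_zero] at habs
    linarith
  have hlam0 : ∀ j, lam j ≠ 0 := fun j h0 => by
    have := hunstable j
    rw [h0, norm_zero] at this
    linarith
  have hdet1 : 1 ≤ A.det ^ 2 := by rw [← sq_abs]; nlinarith
  have hh0 : h i₀ ≠ 0 := by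
    intro h0
    rw [h0] at hdet
    nlinarith
  have hAinv := tendsto_inv_pow hlam hdistinct hunstable hA
  obtain ⟨c, hc⟩ := exists_observable hlam hdistinct hA hlam0
  obtain ⟨X, hX, hXA⟩ := exists_gramian hA hAinv hc
  obtain ⟨G, hG, hGrow⟩ := exists_singleRow i₀ c
  have htr := one_add_trace_gramian hX hXA
  rw [← hG] at hXA htr
  obtain ⟨N, hN, hNeq⟩ := exists_processNoise_cov hA hAinv hX hQs hXA
  have hric := riccati_gramian hA hX hXA
  generalize kalmanGain X⁻¹ G 1 = K at hNeq hric
  -- the scale `a` of the encoder: the excess power due to the process noise is at most `a² τ`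
  set τ := (N * (Gᵀ * G)).trace with hτ
  obtain ⟨a, ha, haτ⟩ : ∃ a : ℝ, 0 < a ∧ a ^ 2 * τ ≤ 1 + h i₀ ^ 2 * p - A.det ^ 2 := by
    have hε : 0 < 1 + h i₀ ^ 2 * p - A.det ^ 2 := by linarith
    refine ⟨√((1 + h i₀ ^ 2 * p - A.det ^ 2) / (|τ| + 1)), by positivity, ?_⟩
    rw [Real.sq_sqrt (by positivity), div_mul_eq_mul_div, div_le_iff₀ (by positivity)]
    nlinarith [le_abs_self τ]
  set B := (a ^ 2)⁻¹ • X⁻¹ + N with hB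
  have hXinv : (X⁻¹).PosSemidef := hX.inv.posSemidef
  have ha2 : (0 : ℝ) ≤ (a ^ 2)⁻¹ := by positivity
  have hane := ha.ne'
  have hstep : A * updateCov B (a • G) 1 (a⁻¹ • K) * Aᵀ + Q = B := by
    have h1 : updateCov B (a • G) 1 (a⁻¹ • K) = (a ^ 2)⁻¹ • updateCov X⁻¹ G 1 K
        + (1 - K * G) * N * (1 - K * G)ᵀ := by
      have h2 : a⁻¹ • K * a • G = K * G := by
        rw [Matrix.smul_mul, Matrix.mul_smul, smul_smul, inv_mul_cancel₀ hane, one_smul]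
      rw [updateCov, updateCov, h2, hB, transpose_smul]
      simp only [Matrix.mul_add, Matrix.add_mul, Matrix.smul_mul, Matrix.mul_smul, smul_smul,
        smul_add, Matrix.mul_one]
      rw [show a⁻¹ * a⁻¹ = (a ^ 2)⁻¹ by rw [sq, mul_inv]]
      abel
    rw [h1, Matrix.mul_add, Matrix.add_mul, Matrix.mul_smul, Matrix.smul_mul, hric, add_assoc, hNeq]
  have hBQ : (B - Q).PosSemidef := by
    have h1 := posSemidef_conj A (posSemidef_conj (1 - K * G) hN)
    have h2 : B - Q = (a ^ 2)⁻¹ • X⁻¹ + A * ((1 - K * G) * N * (1 - K * G)ᵀ) * Aᵀ := by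
      rw [hB]
      conv_lhs => rw [← hNeq]
      abel
    rw [h2]
    exact (hXinv.smul ha2).add h1
  have hbound := posSemidef_sub_errorCov hQs (R := 1) .one (a⁻¹ • K) hBQ hstep
  set Γ : Matrix (Fin n) (Fin k) ℝ := (a / h i₀) • G with hΓ
  have hHΓ : diagonal h * Γ = a • G := by
    ext i j
    rw [diagonal_mul, hΓ, Matrix.smul_apply, Matrix.smul_apply, smul_eq_mul, smul_eq_mul]
    by_cases hi : i = i₀
    · subst hi; field_simp
    · rw [hGrow i hi, mul_zero, mul_zero, mul_zero]
  have hR : outputNoiseCov h (0 : Matrix (Fin n) (Fin n) ℝ) = 1 := by simp [outputNoiseCov]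
  obtain ⟨Ω, mΩ, μ, hμ, S, W, Z, M, Xs, Y, hr⟩ := exists_isRealization A Q h Γ 0
  have hd := fun t => hr.exists_decoder hQs .zero t
  choose g hgm hg using hd
  refine ⟨Real.toNNReal B.trace, Γ, 0, .zero, Ω, mΩ, μ, hμ, S, W, Z, M, Xs, Y, hr,
    longTermAverage_le_of_forall_le fun t => ?_, g, hgm,
    longTermAverage_le_of_forall_le fun t => ?_⟩
  · rw [hr.lintegral_enorm_sq_input hQs .zero t, hHΓ, hR, add_zero]
    refine ENNReal.ofReal_le_ofReal ?_
    have h1 := (posSemidef_conj Γ (hbound t)).trace_nonneg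
    rw [Matrix.mul_sub, Matrix.sub_mul, trace_sub] at h1
    have h2 : (Γ * B * Γᵀ).trace = (h i₀ ^ 2)⁻¹ * (A.det ^ 2 - 1 + a ^ 2 * τ) := by
      rw [Matrix.mul_assoc, trace_mul_comm, Matrix.mul_assoc, hΓ, transpose_smul, hB, ← htr, hτ]
      simp only [Matrix.smul_mul, Matrix.mul_smul, smul_smul, Matrix.add_mul, trace_add,
        trace_smul, smul_eq_mul]
      field_simp
      ring
    have h3 : (Γ * B * Γᵀ).trace ≤ p := by
      rw [h2, inv_mul_le_iff₀ (by positivity)]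
      linarith
    linarith
  · rw [hg t, hHΓ, hR, ← ENNReal.ofReal]
    refine ENNReal.ofReal_le_ofReal ?_
    have h1 := (hbound t).trace_nonneg
    rw [trace_sub] at h1
    linarith

end Achievability

/-! ### Determinant inequalities -/

section Determinants

variable {k n : ℕ}

lemma one_add_sum_le_prod_one_add {ι : Type*} (s : Finset ι) {f : ι → ℝ} (hf : ∀ i, 0 ≤ f i) :
    1 + ∑ i ∈ s, f i ≤ ∏ i ∈ s, (1 + f i) := by
  classical
  induction s using Finset.induction_on with
  | empty => simp
  | insert a s ha ih =>
    rw [Finset.sum_insert ha, Finset.prod_insert ha]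
    have h1 := Finset.sum_nonneg (s := s) fun i _ => hf i
    nlinarith [hf a, mul_nonneg (hf a) h1]

lemma one_add_trace_le_det {P : Matrix (Fin k) (Fin k) ℝ} (hP : P.PosSemidef) :
    1 + P.trace ≤ (1 + P).det := by
  have hH := hP.isHermitian
  have h1 : (1 + P).det = ∏ i, (1 + hH.eigenvalues i) := by
    have h2 := eval_charpoly P (-1)
    rw [hH.charpoly_eq, Polynomial.eval_prod] at h2
    have h3 : scalar (Fin k) (-1 : ℝ) - P = -(1 + P) := by
      rw [scalar_apply, ← smul_one_eq_diagonal]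
      simp
      abel
    rw [h3, det_neg, Fintype.card_fin] at h2
    have h4 : ∏ i, (-1 - hH.eigenvalues i) = (-1) ^ k * ∏ i, (1 + hH.eigenvalues i) := by
      rw [show (-1 : ℝ) ^ k = ∏ _i : Fin k, (-1 : ℝ) by simp, ← Finset.prod_mul_distrib]
      exact Finset.prod_congr rfl fun i _ => by ring
    simp only [Polynomial.eval_sub, Polynomial.eval_X, Polynomial.eval_C, RCLike.ofReal_real_eq_id,
      id] at h2
    rw [h4] at h2
    exact (mul_left_cancel₀ (pow_ne_zero k (by norm_num)) h2).symm
  rw [h1, hH.trace_eq_sum_eigenvalues]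
  simpa using one_add_sum_le_prod_one_add Finset.univ hP.eigenvalues_nonneg

lemma det_le_trace_pow {P : Matrix (Fin k) (Fin k) ℝ} (hP : P.PosSemidef) :
    P.det ≤ P.trace ^ k := by
  have hH := hP.isHermitian
  rw [hH.det_eq_prod_eigenvalues, hH.trace_eq_sum_eigenvalues]
  simp only [RCLike.ofReal_real_eq_id, id]
  calc ∏ i, hH.eigenvalues i ≤ ∏ _i : Fin k, ∑ j, hH.eigenvalues j :=
        Finset.prod_le_prod (fun i _ => hP.eigenvalues_nonneg i) fun i hi =>
          Finset.single_le_sum (fun j _ => hP.eigenvalues_nonneg j) hi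
    _ = _ := by simp

open scoped MatrixOrder Matrix.Norms.L2Operator in
lemma exists_factor {P : Matrix (Fin k) (Fin k) ℝ} (hP : P.PosSemidef) :
    ∃ T : Matrix (Fin k) (Fin k) ℝ, P = Tᵀ * T := by
  obtain ⟨T, hT⟩ := CStarAlgebra.nonneg_iff_eq_star_mul_self.mp hP.nonneg
  exact ⟨T, by rwa [star_eq_conjTranspose, conjTranspose_eq_transpose_of_trivial] at hT⟩

/-- The inequality `N⁻¹ ≥ (tr N)⁻¹`, which holds because the trace dominates the eigenvalues of `N`.
For `N = Tᵀ T` it is the Cauchy-Schwarz inequality for the columns of `T`. -/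
lemma dotProduct_self_le_trace_mul {N : Matrix (Fin k) (Fin k) ℝ} (hN : N.PosDef) (x : Fin k → ℝ) :
    x ⬝ᵥ x ≤ N.trace * (x ⬝ᵥ N⁻¹ *ᵥ x) := by
  obtain ⟨T, hT⟩ := exists_factor hN.posSemidef
  have hNu : IsUnit N.det := (isUnit_iff_isUnit_det _).mp hN.isUnit
  obtain ⟨y, rfl⟩ : ∃ y, x = N *ᵥ y := ⟨N⁻¹ *ᵥ x, by rw [mulVec_mulVec, mul_nonsing_inv _ hNu,
    one_mulVec]⟩
  rw [mulVec_mulVec, nonsing_inv_mul _ hNu, one_mulVec]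
  have h1 : N *ᵥ y = Tᵀ *ᵥ (T *ᵥ y) := by rw [mulVec_mulVec, ← hT]
  have h2 : (N *ᵥ y) ⬝ᵥ y = (T *ᵥ y) ⬝ᵥ (T *ᵥ y) := by
    rw [h1, mulVec_transpose, ← dotProduct_mulVec]
  have h3 : N.trace = ∑ i, ∑ j, T j i ^ 2 := by
    rw [hT, trace]
    simp [mul_apply, sq]
  rw [h2, h1, h3, Finset.sum_mul, dotProduct]
  refine Finset.sum_le_sum fun i _ => ?_
  have := Finset.sum_mul_sq_le_sq_mul_sq Finset.univ (fun j => T j i) (T *ᵥ y)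
  simp only [dotProduct, ← sq]
  exact this

lemma trace_conj_eq_sum {m : ℕ} (T : Matrix (Fin m) (Fin n) ℝ) (B : Matrix (Fin n) (Fin n) ℝ) :
    (T * B * Tᵀ).trace = ∑ i, T i ⬝ᵥ B *ᵥ T i := by
  simp only [trace, diag_apply]
  refine Finset.sum_congr rfl fun i _ => ?_
  rw [Matrix.mul_assoc, mul_apply, dotProduct]
  rfl

/-- Adding the process noise increases the determinant by a definite factor: for `Q = Tᵀ T`, the
factor is `det (1 + T N⁻¹ Tᵀ) ≥ 1 + tr (T N⁻¹ Tᵀ)`. -/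
lemma det_mul_le_det_add {N Q : Matrix (Fin k) (Fin k) ℝ} (hN : N.PosDef) (hQ : Q.PosSemidef) :
    N.det * (1 + Q.trace / (N + Q).trace) ≤ (N + Q).det := by
  obtain ⟨T, hT⟩ := exists_factor hQ
  have hNu : IsUnit N.det := (isUnit_iff_isUnit_det _).mp hN.isUnit
  have h1 : N + Q = N * (1 + N⁻¹ * Tᵀ * T) := by
    rw [Matrix.mul_add, Matrix.mul_one, Matrix.mul_assoc, ← hT, ← Matrix.mul_assoc,
      mul_nonsing_inv _ hNu, Matrix.one_mul]
  have h2 : (N + Q).det = N.det * (1 + T * N⁻¹ * Tᵀ).det := by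
    rw [h1, det_mul, det_one_add_mul_comm, Matrix.mul_assoc]
  have h3 := one_add_trace_le_det (posSemidef_conj T hN.inv.posSemidef)
  have h4 : Q.trace ≤ N.trace * (T * N⁻¹ * Tᵀ).trace := by
    have : Q.trace = ∑ i, T i ⬝ᵥ T i := by
      rw [hT, trace_mul_comm]
      simpa using trace_conj_eq_sum T 1
    rw [this, trace_conj_eq_sum, Finset.mul_sum]
    exact Finset.sum_le_sum fun i _ => dotProduct_self_le_trace_mul hN (T i)
  have h5 : Q.trace / (N + Q).trace ≤ (T * N⁻¹ * Tᵀ).trace := by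
    have hQt := hQ.trace_nonneg
    have hNt := hN.posSemidef.trace_nonneg
    have ht := (posSemidef_conj T hN.inv.posSemidef).trace_nonneg
    rw [trace_add]
    refine div_le_of_le_mul₀ (by positivity) ht ?_
    nlinarith
  rw [h2]
  exact mul_le_mul_of_nonneg_left (by linarith) hN.det_pos.le

/-- With the Kalman gain, the determinant of the covariance decreases by the factor `det R / det V`,
where `V` is the covariance of the innovation. -/
lemma det_updateCov_mul {P : Matrix (Fin k) (Fin k) ℝ} (hP : P.PosSemidef)
    (G : Matrix (Fin n) (Fin k) ℝ) {R : Matrix (Fin n) (Fin n) ℝ} (hR : R.PosDef) :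
    (updateCov P G R (kalmanGain P G R)).det * (G * P * Gᵀ + R).det = P.det * R.det := by
  have hV := posDef_innovationCov hP G hR
  have hVu : IsUnit (G * P * Gᵀ + R).det := (isUnit_iff_isUnit_det _).mp hV.isUnit
  have h1 : (1 - G * kalmanGain P G R) * (G * P * Gᵀ + R) = R := by
    rw [Matrix.sub_mul, Matrix.one_mul, Matrix.mul_assoc G (kalmanGain P G R),
      kalmanGain_mul hP G hR, ← Matrix.mul_assoc, add_sub_cancel_left]
  have h2 := congrArg det h1
  rw [det_mul] at h2
  rw [updateCov_kalmanGain hP G hR, det_mul, det_one_sub_mul_comm, ← h2]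
  ring

/-- For a scalar source or a scalar channel, the signal part of the channel output has rank at most
one. This bounds the information that one channel use conveys in terms of the received power. -/
lemma det_innovationCov_le (hkn : n = 1 ∨ k = 1) {P : Matrix (Fin k) (Fin k) ℝ}
    (hP : P.PosSemidef) (G : Matrix (Fin n) (Fin k) ℝ) {E : Matrix (Fin n) (Fin n) ℝ}
    (hE : E.PosSemidef) :
    (G * P * Gᵀ + (E + 1)).det ≤ (E + 1).det * (1 + (G * P * Gᵀ).trace) := by
  obtain ⟨T, hT⟩ := exists_factor hP
  have hR : (E + 1).PosDef := PosDef.posSemidef_add hE .one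
  have hRu : IsUnit (E + 1).det := (isUnit_iff_isUnit_det _).mp hR.isUnit
  set J := T * Gᵀ with hJ
  have hGP : G * P * Gᵀ = Jᵀ * J := by
    rw [hT, hJ, transpose_mul, transpose_transpose]
    simp only [Matrix.mul_assoc]
  have h1 : (G * P * Gᵀ + (E + 1)).det = (E + 1).det * (1 + (E + 1)⁻¹ * Jᵀ * J).det := by
    rw [← det_mul, Matrix.mul_add, Matrix.mul_one, Matrix.mul_assoc (E + 1)⁻¹,
      ← Matrix.mul_assoc (E + 1), mul_nonsing_inv _ hRu, Matrix.one_mul, hGP, add_comm]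
  have h2 : (1 + (E + 1)⁻¹ * Jᵀ * J).det = 1 + (J * (E + 1)⁻¹ * Jᵀ).trace := by
    rcases hkn with rfl | rfl
    · rw [det_fin_one, Matrix.mul_assoc J, trace_mul_comm, trace_fin_one]
      rfl
    · rw [det_one_add_mul_comm, det_fin_one, Matrix.mul_assoc J, trace_fin_one]
      rfl
  have h3 : (J * (E + 1)⁻¹ * Jᵀ).trace ≤ (G * P * Gᵀ).trace := by
    have h4 : (G * P * Gᵀ).trace = (J * (1 : Matrix (Fin n) (Fin n) ℝ) * Jᵀ).trace := by
      rw [hGP, trace_mul_comm, Matrix.mul_one]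
    rw [h4, trace_conj_eq_sum, trace_conj_eq_sum]
    refine Finset.sum_le_sum fun i _ => ?_
    obtain ⟨y, hy⟩ : ∃ y, J i = (E + 1) *ᵥ y := ⟨(E + 1)⁻¹ *ᵥ J i, by
      rw [mulVec_mulVec, mul_nonsing_inv _ hRu, one_mulVec]⟩
    rw [hy, mulVec_mulVec, nonsing_inv_mul _ hRu, one_mulVec, one_mulVec]
    have hEy := hE.dotProduct_mulVec_nonneg y
    have hEE : 0 ≤ (E *ᵥ y) ⬝ᵥ (E *ᵥ y) := Finset.sum_nonneg fun i _ => mul_self_nonneg _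
    rw [star_trivial, dotProduct_comm] at hEy
    simp only [add_mulVec, one_mulVec, add_dotProduct, dotProduct_add]
    rw [dotProduct_comm y (E *ᵥ y)]
    linarith
  rw [h1, h2]
  exact mul_le_mul_of_nonneg_left (by linarith) hR.det_pos.le

/-- The received power is at most the transmitted power times the square of the largest gain. -/
lemma trace_received_le {h : Fin n → ℝ} {H : ℝ} (hH : ∀ i, h i ^ 2 ≤ H)
    {V : Matrix (Fin n) (Fin n) ℝ} (hV : V.PosSemidef) :
    (diagonal h * V * (diagonal h)ᵀ).trace ≤ H * V.trace := by
  rw [trace, trace, Finset.mul_sum]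
  refine Finset.sum_le_sum fun i _ => ?_
  have h1 : 0 ≤ V i i := hV.diag_nonneg
  rw [diag_apply, diag_apply, diagonal_transpose, mul_diagonal, diagonal_mul]
  nlinarith [hH i]

/-- One step of the converse: up to the factor due to the process noise, the volume of the error
ellipsoid grows by `det A ^ 2` and shrinks by at most `1 + H a`, where `a` is the power. -/
lemma det_errorCov_succ (hkn : n = 1 ∨ k = 1) {A Q : Matrix (Fin k) (Fin k) ℝ} (hQ : Q.PosDef)
    (hA : A.det ≠ 0) {h : Fin n → ℝ} {H : ℝ} (hH0 : 0 ≤ H) (hH : ∀ i, h i ^ 2 ≤ H)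
    (Γ : Matrix (Fin n) (Fin k) ℝ) {Sig : Matrix (Fin n) (Fin n) ℝ} (hSig : Sig.PosSemidef)
    {P : ℕ → Matrix (Fin k) (Fin k) ℝ}
    (hP : P = errorCov A Q (diagonal h * Γ) (outputNoiseCov h Sig)) (t : ℕ) :
    0 < (P t).det ∧ A.det ^ 2 * (P t).det * (1 + Q.trace / (P (t + 1)).trace)
      ≤ (P (t + 1)).det * (1 + H * (Γ * P t * Γᵀ + Sig).trace) := by
  have hR := posDef_outputNoiseCov h hSig
  have hpsd : ∀ t, (P t).PosSemidef := fun t => hP ▸ posSemidef_errorCov A hQ.posSemidef _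
    hR.posSemidef t
  have hpd : ∀ t, 0 < (P t).det := by
    intro t
    cases t with
    | zero => rw [hP]; exact hQ.det_pos
    | succ t =>
      have : P (t + 1) = A * updateCov (P t) (diagonal h * Γ) (outputNoiseCov h Sig)
        (kalmanGain (P t) (diagonal h * Γ) (outputNoiseCov h Sig)) * Aᵀ + Q := by rw [hP]; rfl
      rw [this]
      exact (PosDef.posSemidef_add (posSemidef_conj A
        (posSemidef_updateCov (hpsd t) _ hR.posSemidef _)) hQ).det_pos
  refine ⟨hpd t, ?_⟩
  set G := diagonal h * Γ with hG
  have hsucc : P (t + 1) = A * updateCov (P t) G (outputNoiseCov h Sig)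
        (kalmanGain (P t) G (outputNoiseCov h Sig)) * Aᵀ + Q := by rw [hP]; rfl
  set U := updateCov (P t) G (outputNoiseCov h Sig) (kalmanGain (P t) G (outputNoiseCov h Sig))
    with hU
  have hUV := det_updateCov_mul (hpsd t) G hR
  rw [← hU] at hUV
  have hVpos := (posDef_innovationCov (hpsd t) G hR).det_pos
  have hUpos : 0 < U.det := by
    have := mul_pos (hpd t) hR.det_pos
    rw [← hUV] at this
    exact pos_of_mul_pos_left this hVpos.le
  have hUpsd : U.PosSemidef := posSemidef_updateCov (hpsd t) _ hR.posSemidef _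
  have hNdet : (A * U * Aᵀ).det = A.det ^ 2 * U.det := by
    rw [det_mul, det_mul, det_transpose]; ring
  have hNpd : (A * U * Aᵀ).PosDef := by
    rw [(posSemidef_conj A hUpsd).posDef_iff_det_ne_zero, hNdet]
    positivity
  have h1 := det_mul_le_det_add hNpd hQ.posSemidef
  rw [← hsucc, hNdet] at h1
  have h2 : (G * P t * Gᵀ + outputNoiseCov h Sig).det
      ≤ (outputNoiseCov h Sig).det * (1 + (G * P t * Gᵀ).trace) :=
    det_innovationCov_le hkn (hpsd t) G (posSemidef_conj (diagonal h) hSig)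
  have h3 : (G * P t * Gᵀ).trace ≤ H * (Γ * P t * Γᵀ + Sig).trace := by
    have h4 := trace_received_le hH (posSemidef_conj Γ (hpsd t))
    have h5 : G * P t * Gᵀ = diagonal h * (Γ * P t * Γᵀ) * (diagonal h)ᵀ := by
      rw [hG, transpose_mul]
      simp only [Matrix.mul_assoc]
    rw [h5, trace_add, mul_add]
    have := mul_nonneg hH0 hSig.trace_nonneg
    linarith
  have h6 : (P t).det ≤ U.det * (1 + H * (Γ * P t * Γᵀ + Sig).trace) := by
    have h7 : (P t).det * (outputNoiseCov h Sig).det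
        ≤ U.det * (1 + H * (Γ * P t * Γᵀ + Sig).trace) * (outputNoiseCov h Sig).det := by
      rw [← hUV]
      have := mul_le_mul_of_nonneg_left h2 hUpos.le
      have h8 := mul_le_mul_of_nonneg_left h3 (mul_pos hUpos hR.det_pos).le
      nlinarith
    exact le_of_mul_le_mul_right h7 hR.det_pos
  have hfac : 0 ≤ 1 + Q.trace / (P (t + 1)).trace :=
    add_nonneg zero_le_one (div_nonneg hQ.posSemidef.trace_nonneg (hpsd (t + 1)).trace_nonneg)
  have hpow : 0 ≤ 1 + H * (Γ * P t * Γᵀ + Sig).trace :=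
    add_nonneg zero_le_one (mul_nonneg hH0
      ((posSemidef_conj Γ (hpsd t)).add hSig).trace_nonneg)
  calc A.det ^ 2 * (P t).det * (1 + Q.trace / (P (t + 1)).trace)
      ≤ A.det ^ 2 * (U.det * (1 + H * (Γ * P t * Γᵀ + Sig).trace))
          * (1 + Q.trace / (P (t + 1)).trace) := by gcongr
    _ = A.det ^ 2 * U.det * (1 + Q.trace / (P (t + 1)).trace)
          * (1 + H * (Γ * P t * Γᵀ + Sig).trace) := by ring
    _ ≤ _ := by gcongr

end Determinants

/-! ### Long-term averages -/

section Averages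

lemma eventually_sum_le_of_longTermAverage_le {u : ℕ → ℝ} (hu : ∀ t, 0 ≤ u t) {b : ℝ} (hb : 0 ≤ b)
    (h : longTermAverage (fun t => ENNReal.ofReal (u t)) ≤ ENNReal.ofReal b) {ε : ℝ} (hε : 0 < ε) :
    ∀ᶠ T : ℕ in atTop, ∑ t ∈ Finset.Icc 1 T, u t ≤ (b + ε) * T := by
  have h1 : longTermAverage (fun t => ENNReal.ofReal (u t)) < ENNReal.ofReal (b + ε) :=
    h.trans_lt ((ENNReal.ofReal_lt_ofReal_iff (by linarith)).mpr (by linarith))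
  filter_upwards [eventually_lt_of_limsup_lt h1, eventually_gt_atTop 0] with T hT hT0
  have hTpos : (0 : ℝ) < T := by exact_mod_cast hT0
  rw [← ENNReal.ofReal_sum_of_nonneg fun t _ => hu t, ← ENNReal.ofReal_natCast,
    ← ENNReal.ofReal_div_of_pos hTpos] at hT
  have h2 := (ENNReal.ofReal_lt_ofReal_iff (by linarith)).mp hT
  rw [div_lt_iff₀ hTpos] at h2
  exact h2.le

/-- The growth of the log-volume `ℓ` of the error ellipsoid is at least `ρ` minus the information
received, plus a contribution of the process noise that is bounded away from zero as long as the
mean-squared error `τ` stays bounded. If `ρ` were at least the capacity `log (1 + H p)`, then `ℓ`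
would grow linearly, which contradicts its logarithmic bound in terms of `τ`. The information is
bounded above by its tangent at the power bound `p`, and the noise contribution is bounded below by
an affine function of `τ`. -/
lemma rate_lt_of_bounded_average {ℓ a τ : ℕ → ℝ} {ρ H q p D : ℝ} {d : ℕ} (ha : ∀ t, 0 ≤ a t)
    (hτ : ∀ t, 0 < τ t) (hq : 0 < q) (hH : 0 ≤ H) (hp : 0 ≤ p) (hD : 0 ≤ D)
    (hstep : ∀ t, ℓ t + ρ + Real.log (1 + q / τ (t + 1)) ≤ ℓ (t + 1) + Real.log (1 + H * a t))
    (hℓ : ∀ t, ℓ t ≤ d * Real.log (τ t))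
    (hpow : longTermAverage (fun t => ENNReal.ofReal (a t)) ≤ ENNReal.ofReal p)
    (herr : longTermAverage (fun t => ENNReal.ofReal (τ t)) ≤ ENNReal.ofReal D) :
    ρ < Real.log (1 + H * p) := by
  by_contra! hρ
  set m := D + 1 + q with hm
  have hm0 : 0 < m := by positivity
  set ε := q / (2 * m * (H + 1)) with hε
  have hε0 : 0 < ε := by positivity
  have hHε : H * ε ≤ q / (2 * m) := by
    rw [hε, mul_div_assoc', div_le_div_iff₀ (by positivity) (by positivity)]
    nlinarith [mul_pos hq hm0, mul_nonneg (mul_pos hq hm0).le hH]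
  set κ := q / (2 * m) with hκ
  have hκ0 : 0 < κ := by positivity
  -- the information lies below its tangent at `p`, the noise contribution above an affine function
  have htan1 : ∀ t, Real.log (1 + H * a t) ≤ ρ + H * (a t - p) / (1 + H * p) := by
    intro t
    have h1 : 0 < 1 + H * p := by positivity
    have h2 : 0 < 1 + H * a t := by have := ha t; positivity
    have h3 := Real.log_le_sub_one_of_pos (div_pos h2 h1)
    rw [Real.log_div h2.ne' h1.ne'] at h3
    have h4 : (1 + H * a t) / (1 + H * p) - 1 = H * (a t - p) / (1 + H * p) := by
      field_simp; ring
    linarith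
  have htan2 : ∀ t, q * (2 / m - (τ t + q) / m ^ 2) ≤ Real.log (1 + q / τ t) := by
    intro t
    have h0 := hτ t
    have h1 : 0 < 1 + q / τ t := by positivity
    have h2 := Real.one_sub_inv_le_log_of_pos h1
    have h3 : 1 - (1 + q / τ t)⁻¹ = q / (τ t + q) := by
      field_simp
      ring
    rw [h3] at h2
    refine le_trans ?_ h2
    rw [div_eq_mul_inv q (τ t + q)]
    refine mul_le_mul_of_nonneg_left ?_ hq.le
    have h4 : 0 < τ t + q := by positivity
    rw [← sub_nonneg]
    have : (τ t + q)⁻¹ - (2 / m - (τ t + q) / m ^ 2)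
        = (τ t + q - m) ^ 2 / ((τ t + q) * m ^ 2) := by
      field_simp
      ring
    rw [this]
    positivity
  have hsum : ∀ T : ℕ, ℓ 1 + ∑ t ∈ Finset.Icc 1 T, (q * (2 / m - (τ (t + 1) + q) / m ^ 2)
      - H * (a t - p) / (1 + H * p)) ≤ ℓ (T + 1) := by
    intro T
    induction T with
    | zero => simp
    | succ T ih =>
      rw [Finset.sum_Icc_succ_top (by omega)]
      have h1 := hstep (T + 1)
      have h2 := htan1 (T + 1)
      have h3 := htan2 (T + 1 + 1)
      linarith
  have hlog : ∀ᶠ T : ℕ in atTop, d * Real.log ((D + 1) * (T + 1)) ≤ κ / 4 * (T + 1) := by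
    have h1 : Tendsto (fun T : ℕ => (D + 1) * ((T : ℝ) + 1)) atTop atTop :=
      (tendsto_atTop_add_const_right _ _ tendsto_natCast_atTop_atTop).const_mul_atTop
        (by positivity)
    have h2 := h1.eventually (Real.isLittleO_log_id_atTop.def
      (c := κ / 4 / ((d + 1) * (D + 1))) (by positivity))
    filter_upwards [h2] with T hT
    have h3 : Real.log ((D + 1) * (T + 1)) ≤ κ / 4 / ((d + 1) * (D + 1)) * ((D + 1) * (T + 1)) := by
      refine (le_abs_self _).trans (hT.trans (le_of_eq ?_))
      rw [id, Real.norm_of_nonneg (by positivity)]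
    have h4 : κ / 4 / ((d + 1) * (D + 1)) * ((D + 1) * (T + 1)) = κ / 4 * (T + 1) / (d + 1) := by
      field_simp
    rw [h4] at h3
    calc d * Real.log ((D + 1) * (T + 1)) ≤ d * (κ / 4 * (T + 1) / (d + 1)) := by gcongr
      _ = κ / 4 * (T + 1) * (d / (d + 1)) := by ring
      _ ≤ κ / 4 * (T + 1) * 1 := by
        gcongr
        rw [div_le_one (by positivity)]
        linarith
      _ = _ := by ring
  have hE1 := eventually_sum_le_of_longTermAverage_le ha hp hpow hε0
  have hE2 := (tendsto_add_atTop_nat 1).eventually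
    (eventually_sum_le_of_longTermAverage_le (fun t => (hτ t).le) hD herr (ε := 1 / 2)
      (by norm_num))
  have hE3 : ∀ᶠ T : ℕ in atTop, 2 * (D + 1) + 1 + (2 * |ℓ 1| + κ) / κ ≤ (T : ℝ) :=
    tendsto_natCast_atTop_atTop.eventually_ge_atTop _
  obtain ⟨T, hT1, hT2, hT3, hT4⟩ := (hE1.and (hE2.and (hE3.and hlog))).exists
  have hfrac : 0 ≤ (2 * |ℓ 1| + κ) / κ := by positivity
  have hTD : 2 * (D + 1) + 1 ≤ (T : ℝ) := by linarith
  have hTℓ : 2 * |ℓ 1| + κ ≤ κ * T := by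
    have : (2 * |ℓ 1| + κ) / κ ≤ (T : ℝ) := by linarith
    rwa [div_le_iff₀ hκ0, mul_comm (T : ℝ)] at this
  push_cast at hT2
  -- the mean-squared errors at the times `2, …, T + 1`
  have hτsum : ∑ t ∈ Finset.Icc 1 T, τ (t + 1) ≤ (D + 1) * T := by
    have h1 : ∑ t ∈ Finset.Icc 1 T, τ (t + 1) + τ 1 = ∑ t ∈ Finset.Icc 1 (T + 1), τ t := by
      clear hT1 hT2 hT3 hT4 hTD hTℓ
      induction T with
      | zero => simp
      | succ T ih =>
        rw [Finset.sum_Icc_succ_top (by omega), Finset.sum_Icc_succ_top (b := T + 1) (by omega),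
          ← ih]
        ring
    have h2 := hτ 1
    nlinarith
  have hτlast : τ (T + 1) ≤ (D + 1) * (T + 1) := by
    have h1 : τ (T + 1) ≤ ∑ t ∈ Finset.Icc 1 (T + 1), τ t :=
      Finset.single_le_sum (fun t _ => (hτ t).le) (by simp)
    have : (D + 1 / 2) * ((T : ℝ) + 1) ≤ (D + 1) * (T + 1) := by gcongr; norm_num
    linarith
  have hupper : ℓ (T + 1) ≤ κ / 4 * (T + 1) := by
    refine (hℓ (T + 1)).trans (le_trans ?_ hT4)
    gcongr
    exact hτ _
  have hlower := hsum T
  rw [Finset.sum_sub_distrib, ← Finset.mul_sum, Finset.sum_sub_distrib, ← Finset.sum_div,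
    ← Finset.sum_div, Finset.sum_add_distrib, ← Finset.sum_div, ← Finset.mul_sum,
    Finset.sum_sub_distrib] at hlower
  simp only [Finset.sum_const, Nat.card_Icc, Nat.add_sub_cancel, nsmul_eq_mul] at hlower
  have hA : H * (∑ t ∈ Finset.Icc 1 T, a t - T * p) / (1 + H * p) ≤ κ * T := by
    rw [div_le_iff₀ (by positivity)]
    have h1 : H * (∑ t ∈ Finset.Icc 1 T, a t - T * p) ≤ H * (ε * T) := by
      gcongr
      linarith
    have h2 : H * (ε * T) ≤ κ * T := by
      rw [← mul_assoc]
      gcongr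
    have h3 : 0 ≤ κ * T * (H * p) := by positivity
    linarith
  have hB : 2 * κ * T ≤ q * (T * (2 / m) - (∑ t ∈ Finset.Icc 1 T, τ (t + 1) + T * q) / m ^ 2) := by
    have h1 : (∑ t ∈ Finset.Icc 1 T, τ (t + 1) + T * q) / m ^ 2 ≤ T / m := by
      rw [div_le_div_iff₀ (by positivity) hm0]
      have : ∑ t ∈ Finset.Icc 1 T, τ (t + 1) + T * q ≤ T * m := by
        rw [hm]; linarith
      nlinarith
    have h2 : 2 * κ * T = q * (T * (2 / m) - T / m) := by
      rw [hκ]; field_simp; ring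
    rw [h2]
    gcongr
  have habs := neg_abs_le (ℓ 1)
  rw [mul_div_assoc (T : ℝ) 2] at hlower
  linarith [abs_nonneg (ℓ 1)]

end Averages

/-! ### The converse and the partition condition -/

variable {k n : ℕ}

/-- The converse, for a scalar source or a scalar channel whose squared gains are at most `H`. -/
theorem log_det_sq_lt_of_finiteMSEAchievable (hk : 0 < k) (hkn : n = 1 ∨ k = 1)
    {A Q : Matrix (Fin k) (Fin k) ℝ} (hQ : Q.PosDef) (hA : A.det ≠ 0) {h : Fin n → ℝ} {H : ℝ}
    (hH0 : 0 ≤ H) (hH : ∀ i, h i ^ 2 ≤ H) {p : ℝ} (hp : 0 ≤ p)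
    (hach : FiniteMSEAchievable A Q h p) : Real.log (A.det ^ 2) < Real.log (1 + H * p) := by
  obtain ⟨D, Γ, Sig, hSig, Ω, mΩ, μ, hμ, S, W, Z, M, X, Y, hr, hpow, g, hg, herr⟩ := hach
  have hQs := hQ.posSemidef
  have hR := posDef_outputNoiseCov h hSig
  obtain ⟨P, hP⟩ : ∃ P, P = errorCov A Q (diagonal h * Γ) (outputNoiseCov h Sig) := ⟨_, rfl⟩
  have hpsd : ∀ t, (P t).PosSemidef := fun t => hP ▸ posSemidef_errorCov A hQs _ hR.posSemidef t
  have hstep := det_errorCov_succ hkn hQ hA hH0 hH Γ hSig hP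
  have : NeZero k := ⟨hk.ne'⟩
  have hpd : ∀ t, (P t).PosDef := fun t =>
    (hpsd t).posDef_iff_det_ne_zero.mpr (hstep t).1.ne'
  have hτ : ∀ t, 0 < (P t).trace := fun t => (hpd t).trace_pos
  have hq : 0 < Q.trace := hQ.trace_pos
  have ha : ∀ t, 0 ≤ (Γ * P t * Γᵀ + Sig).trace := fun t =>
    ((posSemidef_conj Γ (hpsd t)).add hSig).trace_nonneg
  refine rate_lt_of_bounded_average (ℓ := fun t => Real.log (P t).det)
    (a := fun t => (Γ * P t * Γᵀ + Sig).trace) (τ := fun t => (P t).trace) (q := Q.trace)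
    (D := D) (d := k) ha hτ hq hH0 hp D.2 (fun t => ?_) (fun t => ?_) ?_ ?_
  · have h1 := (hstep t).2
    have h2 := (hstep t).1
    have h3 := (hstep (t + 1)).1
    have h4 : 0 < 1 + Q.trace / (P (t + 1)).trace :=
      add_pos one_pos (div_pos hq (hτ _))
    have h5 : 0 < 1 + H * (Γ * P t * Γᵀ + Sig).trace := by
      have := mul_nonneg hH0 (ha t); linarith
    have h6 : 0 < A.det ^ 2 := by positivity
    have h7 := Real.log_le_log (by positivity) h1
    rw [Real.log_mul (by positivity) h4.ne', Real.log_mul h6.ne' h2.ne',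
      Real.log_mul h3.ne' h5.ne'] at h7
    linarith
  · rw [← Real.log_pow]
    exact Real.log_le_log (hstep t).1 (det_le_trace_pow (hpsd t))
  · refine le_trans (le_of_eq ?_) hpow
    congr 1
    funext t
    rw [hr.lintegral_enorm_sq_input hQs hSig t, hP]
  · rw [ENNReal.ofReal_coe_nnreal]
    refine le_trans ?_ herr
    refine limsup_le_limsup (.of_forall fun T => ?_) (by isBoundedDefault) (by isBoundedDefault)
    refine ENNReal.div_le_div_right (Finset.sum_le_sum fun t _ => ?_) _
    rw [hP]
    exact hr.ofReal_trace_le_lintegral hQs hSig t (hg t)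

/-- The achievability region of linear time-invariant codes for a scalar source or a scalar
channel. -/
theorem finiteMSEAchievable_iff (hk : 0 < k) (hn : 0 < n) (hkn : n = 1 ∨ k = 1)
    {A Q : Matrix (Fin k) (Fin k) ℝ} (hQ : Q.PosDef) {lam : Fin k → ℂ}
    (hlam : A.charpoly.map (algebraMap ℝ ℂ) = ∏ j, (Polynomial.X - Polynomial.C (lam j)))
    (hdistinct : Function.Injective lam) (hunstable : ∀ j, 1 < ‖lam j‖)
    {h : Fin n → ℝ} (horder : ∀ i j, i ≤ j → |h j| ≤ |h i|) {p : ℝ} (hp : 0 ≤ p) :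
    FiniteMSEAchievable A Q h p ↔
      ∑ j, Real.log ‖lam j‖ < 1 / 2 * Real.log (1 + h ⟨0, hn⟩ ^ 2 * p) := by
  have hpos : ∀ j, 0 < ‖lam j‖ := fun j => one_pos.trans (hunstable j)
  have hdet := abs_det_eq_prod_norm hlam hdistinct
  have hdetpos : 0 < |A.det| := by rw [hdet]; exact Finset.prod_pos fun j _ => hpos j
  have hA : A.det ≠ 0 := abs_pos.mp hdetpos
  have hsum : 2 * ∑ j, Real.log ‖lam j‖ = Real.log (A.det ^ 2) := by
    rw [← Real.log_prod fun j _ => (hpos j).ne', ← hdet, ← sq_abs, Real.log_pow]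
    norm_num
  have hcap : 0 < 1 + h ⟨0, hn⟩ ^ 2 * p := by positivity
  constructor
  · intro hach
    have := log_det_sq_lt_of_finiteMSEAchievable hk hkn hQ hA (sq_nonneg (h ⟨0, hn⟩))
      (fun i => sq_le_sq.mpr (horder ⟨0, hn⟩ i (Nat.zero_le _))) hp hach
    linarith
  · intro hlt
    refine finiteMSEAchievable_of_det_sq_lt hQ hlam hdistinct hunstable ⟨0, hn⟩ ?_
    rw [← Real.log_lt_log_iff (by positivity) hcap]
    linarith

lemma capacity_mono {g g' x y : ℝ} (hg : |g| ≤ |g'|) (hx : 0 ≤ x) (hxy : x ≤ y) :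
    capacity g x ≤ capacity g' y := by
  have h1 : g ^ 2 ≤ g' ^ 2 := sq_le_sq.mpr hg
  have h2 : g ^ 2 * x ≤ g' ^ 2 * y := mul_le_mul h1 hxy hx (sq_nonneg g')
  have h3 : 0 ≤ g ^ 2 * x := by positivity
  exact mul_le_mul_of_nonneg_left (Real.log_le_log (by linarith) (by linarith)) (by norm_num)

lemma PartitionCondition.active {lam : Fin k → ℂ} {h : Fin n → ℝ} {p : ℝ}
    (hc : PartitionCondition lam h p) : ActivePartitionCondition lam h p := by
  obtain ⟨𝒮, π, hal, hlt⟩ := hc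
  exact ⟨𝒮, π, hal, fun i _ => hlt i⟩

/-- For a scalar source or a scalar channel, all modes share one sub-channel, and the best one with
the whole power is the best choice. -/
lemma sum_log_lt_of_activePartitionCondition (hk : 0 < k) (hn : 0 < n) (hkn : n = 1 ∨ k = 1)
    {lam : Fin k → ℂ} {h : Fin n → ℝ} (horder : ∀ i j, i ≤ j → |h j| ≤ |h i|) {p : ℝ}
    (hc : ActivePartitionCondition lam h p) :
    ∑ j, Real.log ‖lam j‖ < capacity (h ⟨0, hn⟩) p := by
  obtain ⟨𝒮, π, hal, hlt⟩ := hc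
  obtain ⟨i, hi⟩ := hal.cover ⟨0, hk⟩
  have huniv : 𝒮 i = Finset.univ := by
    rcases hkn with rfl | rfl
    · refine Finset.eq_univ_iff_forall.mpr fun j => ?_
      obtain ⟨i', hi'⟩ := hal.cover j
      rwa [Subsingleton.elim i i']
    · exact Finset.eq_univ_iff_forall.mpr fun j => Subsingleton.elim (⟨0, hk⟩ : Fin 1) j ▸ hi
  have h1 := hlt i ⟨_, hi⟩
  rw [huniv] at h1
  refine h1.trans_le (capacity_mono (horder ⟨0, hn⟩ i (Nat.zero_le _)) (hal.nonneg i) ?_)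
  rw [← hal.sum_eq]
  exact Finset.single_le_sum (fun i _ => hal.nonneg i) (Finset.mem_univ i)

/-- All modes on the first sub-channel, with the whole power. -/
lemma activePartitionCondition_of_sum_log_lt (hn : 0 < n) {lam : Fin k → ℂ} {h : Fin n → ℝ} {p : ℝ}
    (hp : 0 ≤ p) (hlt : ∑ j, Real.log ‖lam j‖ < capacity (h ⟨0, hn⟩) p) :
    ActivePartitionCondition lam h p := by
  refine ⟨fun i => if i = ⟨0, hn⟩ then Finset.univ else ∅, Pi.single ⟨0, hn⟩ p,
    ⟨fun i j hij => ?_, fun j => ⟨⟨0, hn⟩, by simp⟩, fun i => ?_, ?_⟩, fun i hi => ?_⟩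
  · by_cases hi : i = ⟨0, hn⟩
    · have hj : j ≠ ⟨0, hn⟩ := fun hj => hij (hi.trans hj.symm)
      simp [hj]
    · simp [hi]
  · rw [Pi.single_apply]
    split_ifs <;> simp [hp]
  · simp
  · by_cases hi0 : i = ⟨0, hn⟩
    · subst hi0
      simpa using hlt
    · simp [hi0] at hi

/-- If all gains are nonzero, a small part of the power gives every idle sub-channel a positive
capacity. -/
lemma partitionCondition_of_sum_log_lt (hk : 0 < k) (hn : 0 < n) {lam : Fin k → ℂ}
    (hunstable : ∀ j, 1 < ‖lam j‖) {h : Fin n → ℝ} (hne : ∀ i, h i ≠ 0) {p : ℝ} (hp : 0 ≤ p)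
    (hlt : ∑ j, Real.log ‖lam j‖ < capacity (h ⟨0, hn⟩) p) :
    PartitionCondition lam h p := by
  have hsum0 : 0 < ∑ j, Real.log ‖lam j‖ :=
    Finset.sum_pos (fun j _ => Real.log_pos (hunstable j)) ⟨⟨0, hk⟩, Finset.mem_univ _⟩
  have hp0 : 0 < p := by
    refine lt_of_le_of_ne hp fun h0 => ?_
    rw [← h0] at hlt
    simp only [capacity, mul_zero, add_zero, Real.log_one] at hlt
    linarith
  have hcont : ContinuousAt (fun ε : ℝ => capacity (h ⟨0, hn⟩) (p - n * ε)) 0 := by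
    unfold capacity
    refine ContinuousAt.mul continuousAt_const (ContinuousAt.log (by fun_prop) ?_)
    have : 0 < 1 + h ⟨0, hn⟩ ^ 2 * (p - n * 0) := by
      rw [mul_zero, sub_zero]; positivity
    exact this.ne'
  have hev1 : ∀ᶠ ε in nhdsWithin (0 : ℝ) (Set.Ioi 0),
      ∑ j, Real.log ‖lam j‖ < capacity (h ⟨0, hn⟩) (p - n * ε) :=
    nhdsWithin_le_nhds (hcont.eventually (lt_mem_nhds (by simpa using hlt)))
  have hcont2 : ContinuousAt (fun ε : ℝ => p - n * ε) 0 := by fun_prop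
  have hev2 : ∀ᶠ ε in nhdsWithin (0 : ℝ) (Set.Ioi 0), 0 < p - n * ε :=
    nhdsWithin_le_nhds (hcont2.eventually (lt_mem_nhds (by simpa using hp0)))
  obtain ⟨ε, hε1, hε2, hε⟩ := (hev1.and (hev2.and self_mem_nhdsWithin)).exists
  have hε0 : 0 < ε := hε
  refine ⟨fun i => if i = ⟨0, hn⟩ then Finset.univ else ∅,
    fun i => ε + (Pi.single ⟨0, hn⟩ (p - n * ε) : Fin n → ℝ) i,
    ⟨fun i j hij => ?_, fun j => ⟨⟨0, hn⟩, by simp⟩, fun i => ?_, ?_⟩, fun i => ?_⟩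
  · by_cases hi : i = ⟨0, hn⟩
    · have hj : j ≠ ⟨0, hn⟩ := fun hj => hij (hi.trans hj.symm)
      simp [hj]
    · simp [hi]
  · rw [Pi.single_apply]
    split_ifs <;> linarith
  · rw [Finset.sum_add_distrib]
    simp
  · by_cases hi0 : i = ⟨0, hn⟩
    · subst hi0
      simp only [if_true, Pi.single_eq_same]
      exact hε1.trans_le (capacity_mono le_rfl hε2.le (by linarith))
    · simp only [hi0, if_false, Finset.sum_empty, Pi.single_apply, add_zero]
      have : 0 < h i ^ 2 := by have := hne i; positivity
      exact mul_pos (by norm_num) (Real.log_pos (by nlinarith))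

end CodedKalman

end

/-- `A` is a real matrix whose complex eigenvalues `lam j` are distinct and lie outside the closed
unit disc; `h` lists the gains of the diagonal channel, in order of decreasing magnitude. -/
theorem mainTheorem1 (k n : ℕ) (hk : 0 < k) (hn : 0 < n) (hkn : n = 1 ∨ k = 1)
    (A Q : Matrix (Fin k) (Fin k) ℝ) (hQ : Q.PosDef)
    (lam : Fin k → ℂ)
    (hlam : A.charpoly.map (algebraMap ℝ ℂ) = ∏ j, (Polynomial.X - Polynomial.C (lam j)))
    (hdistinct : Function.Injective lam) (hunstable : ∀ j, 1 < ‖lam j‖)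
    (h : Fin n → ℝ) (horder : ∀ i j, i ≤ j → |h j| ≤ |h i|)
    (p : ℝ) (hp : 0 ≤ p) :
    (CodedKalman.FiniteMSEAchievable A Q h p ↔
      CodedKalman.ActivePartitionCondition lam h p) ∧
    ((∀ i, h i ≠ 0) →
      (CodedKalman.FiniteMSEAchievable A Q h p ↔ CodedKalman.PartitionCondition lam h p)) ∧
    (n = 1 →
      (CodedKalman.FiniteMSEAchievable A Q h p ↔
        ∑ j, Real.log ‖lam j‖ < 1 / 2 * Real.log (1 + h ⟨0, hn⟩ ^ 2 * p))) ∧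
    (k = 1 →
      (CodedKalman.FiniteMSEAchievable A Q h p ↔
        Real.log ‖lam ⟨0, hk⟩‖ < 1 / 2 * Real.log (1 + h ⟨0, hn⟩ ^ 2 * p))) := by
  have hiff := CodedKalman.finiteMSEAchievable_iff hk hn hkn hQ hlam hdistinct hunstable horder hp
  refine ⟨?_, fun hne => ?_, fun _ => hiff, ?_⟩
  · rw [hiff]
    exact ⟨CodedKalman.activePartitionCondition_of_sum_log_lt hn hp,
      CodedKalman.sum_log_lt_of_activePartitionCondition hk hn hkn horder⟩
  · rw [hiff]
    exact ⟨CodedKalman.partitionCondition_of_sum_log_lt hk hn hunstable hne hp, fun hc =>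
      CodedKalman.sum_log_lt_of_activePartitionCondition hk hn hkn horder hc.active⟩
  · rintro rfl
    rw [hiff, Fintype.sum_unique, Subsingleton.elim default (⟨0, hk⟩ : Fin 1)]
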